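/- Let $\mathbb T^2=\mathbb R^2/2\pi\mathbb Z^2$ with complex coordinate $z=x_1+ix_2$, and put $\partial_z=\frac12(\partial_{x_1}-i\partial_{x_2})$, $\partial_{\bar z}=\frac12(\partial_{x_1}+i\partial_{x_2})$. Let $U$ be the unitary operator on $L_2(\mathbb T^2)$ with $Ue_n=\frac{n_1-in_2}{n_1+in_2}e_n$ for $n\in\mathbb Z^2\setminus\{0\}$ and $Ue_0=e_0$, where $e_n(x)=e^{i(n,x)}$ (so that $U\circ\partial_{\bar z}=\partial_z$). For an integer $s\ge 0$ let $H^s(\mathbb T^2)$ be the Sobolev space of all $u\in L_2(\mathbb T^2)$ with $\|u\|_{H^s}^2=\sum_{n\in\mathbb Z^2}(1+|n|^2)^s|\hat u(n)|^2<\infty$. Let $\nu:\mathbb T^2\times[0,1]\to\mathbb C$ be a $C^\infty$ function (up to the boundary in $t$) with $|\nu|<1$ everywhere and $\nu(z,0)\equiv 0$. Then there exists a $C^\infty$ function $f:\mathbb T^2\times[0,1]\to\mathbb C$ such that: 1. $\partial_{\bar z}f=\partial_z(\nu f)$ on $\mathbb T^2$ for every $t\in[0,1]$; 2. $f(z,0)\equiv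 1$; 3. for every fixed $t\in[0,1]$, the function $f(\cdot,t)$ is not identically zero on $\mathbb T^2$; 4. for every integer $s\ge 0$ and every $t\in[0,1]$, the operators $\mathrm{Id}-U\circ\nu(\cdot,t)$ and $U\circ\dot\nu(\cdot,t)$ (where $\nu$ and $\dot\nu=\partial\nu/\partial t$ act by multiplication) are bounded on $H^s(\mathbb T^2)$, the first one is invertible with bounded inverse, and the curve $t\mapsto f(\cdot,t)\in H^s(\mathbb T^2)$ is differentiable on $[0,1]$ in the norm of $H^s(\mathbb T^2)$ and satisfies the linear ordinary differential equation $$\dot f=(\mathrm{Id}-U\circ\nu)^{-1}(U\circ\dot\nu)f .$$ -/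

import Mathlib

open MeasureTheory Set
open scoped ContDiff ENNReal

noncomputable section

namespace TorusBeltrami

/-! ### The torus `ℝ² / 2πℤ²` and smooth families of functions on it -/

/-- The torus `𝕋² = ℝ² / 2πℤ²`, where a point `(x₁, x₂)` is recorded by the pair
`(x₁ / 2π mod 1, x₂ / 2π mod 1)`. -/
abbrev Torus : Type := UnitAddTorus (Fin 2)

/-- The universal covering `ℂ → 𝕋²`, sending `z = x₁ + i x₂` to the class of `(x₁, x₂)` modulo
`2πℤ²`. The standard coordinate of `ℂ` is thus the complex coordinate `z` on `𝕋²`. -/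
def proj (z : ℂ) : Torus :=
  ![((z.re / (2 * Real.pi) : ℝ) : UnitAddCircle), ((z.im / (2 * Real.pi) : ℝ) : UnitAddCircle)]

/-- `g` (of which only the values at times `t ∈ [0,1]` matter) is a `C^∞` function on
`𝕋² × [0,1]`: read in the coordinate `z`, it is `C^∞` on `ℂ × [0,1]`, up to the boundary. -/
def IsSmoothFamily (g : Torus → ℝ → ℂ) : Prop :=
  ContDiffOn ℝ ∞ (fun p : ℂ × ℝ => g (proj p.1) p.2) (univ ×ˢ Icc (0 : ℝ) 1)

/-- The operator `∂_z = (∂_{x₁} - i ∂_{x₂}) / 2` on functions on `𝕋²`, at the point with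
coordinate `z`. -/
def dz (g : Torus → ℂ) (z : ℂ) : ℂ :=
  (fderiv ℝ (fun w : ℂ => g (proj w)) z 1
    - Complex.I * fderiv ℝ (fun w : ℂ => g (proj w)) z Complex.I) / 2

/-- The operator `∂_{z̄} = (∂_{x₁} + i ∂_{x₂}) / 2` on functions on `𝕋²`, at the point with
coordinate `z`. -/
def dzbar (g : Torus → ℂ) (z : ℂ) : ℂ :=
  (fderiv ℝ (fun w : ℂ => g (proj w)) z 1
    + Complex.I * fderiv ℝ (fun w : ℂ => g (proj w)) z Complex.I) / 2

/-- The time derivative of a family at a time `t ∈ [0,1]` (one-sided at the endpoints). -/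
def timeDeriv (g : Torus → ℝ → ℂ) (t : ℝ) : Torus → ℂ :=
  fun x => derivWithin (fun τ => g x τ) (Icc 0 1) t

/-! ### Square integrable functions and their Fourier coefficients -/

/-- The normalized Lebesgue measure on `𝕋²`. -/
abbrev torusMeasure : Measure Torus :=
  Measure.pi fun _ : Fin 2 => (AddCircle.haarAddCircle : Measure UnitAddCircle)

/-- The Hilbert space `L₂(𝕋²)`. -/
abbrev L2 : Type := Lp ℂ 2 torusMeasure

/-- The space of square summable families of Fourier coefficients. -/
abbrev Coeffs : Type := lp (fun _ : Fin 2 → ℤ => ℂ) 2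

/-- The isometry of `L₂(𝕋²)` onto `ℓ₂(ℤ²)` given by the Fourier coefficients with respect to the
orthonormal basis `e_n(x) = exp (i (n, x))`, `n ∈ ℤ²`. -/
def fourierL2 : L2 ≃ₗᵢ[ℂ] Coeffs := (UnitAddTorus.mFourierBasis (d := Fin 2)).repr

/-! ### The unitary operator `U = ∂_{z̄}⁻¹ ∘ ∂_z` -/

/-- The eigenvalue of `U` on `e_n`: it is `(n₁ - i n₂) / (n₁ + i n₂)` for `n ≠ 0`, and `1` for
`n = 0`, so that averages are preserved. -/
def eigU (n : Fin 2 → ℤ) : ℂ :=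
  if n = 0 then 1
  else ((n 0 : ℂ) - Complex.I * (n 1 : ℂ)) / ((n 0 : ℂ) + Complex.I * (n 1 : ℂ))

theorem norm_eigU (n : Fin 2 → ℤ) : ‖eigU n‖ = 1 := by
  unfold eigU
  split_ifs with h
  · simp
  · have h1 : ((n 0 : ℂ) - Complex.I * (n 1 : ℂ))
        = (starRingEnd ℂ) ((n 0 : ℂ) + Complex.I * (n 1 : ℂ)) := by
      simp [sub_eq_add_neg]
    have h2 : (n 0 : ℂ) + Complex.I * (n 1 : ℂ) ≠ 0 := by
      intro h0
      apply h
      have hr := congrArg Complex.re h0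
      have hi := congrArg Complex.im h0
      simp at hr hi
      funext i
      fin_cases i
      · simpa using hr
      · simpa using hi
    rw [h1, norm_div, RCLike.norm_conj]
    exact div_self (norm_ne_zero_iff.mpr h2)

theorem memℓp_mul {m : (Fin 2 → ℤ) → ℂ} (hm : ∀ n, ‖m n‖ = 1) (a : Coeffs) :
    Memℓp (fun n => m n * a n) 2 := by
  refine (lp.memℓp a).mono' fun n => ?_
  simp [hm n]

/-- The diagonal unitary operator on `ℓ₂(ℤ²)` with unimodular eigenvalues `m n`. -/
def diag (m : (Fin 2 → ℤ) → ℂ) (hm : ∀ n, ‖m n‖ = 1) : Coeffs ≃ₗᵢ[ℂ] Coeffs where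
  toFun a := ⟨fun n => m n * a n, memℓp_mul hm a⟩
  invFun a := ⟨fun n => (m n)⁻¹ * a n, memℓp_mul (fun n => by simp [hm n]) a⟩
  map_add' a b := by
    ext n
    exact mul_add _ _ _
  map_smul' c a := by
    ext n
    simp [mul_left_comm]
  left_inv a := by
    ext n
    have : m n ≠ 0 := norm_ne_zero_iff.mp (by simp [hm n])
    simp [this]
  right_inv a := by
    ext n
    have : m n ≠ 0 := norm_ne_zero_iff.mp (by simp [hm n])
    simp [this]
  norm_map' a := by
    rw [lp.norm_eq_tsum_rpow (by simp), lp.norm_eq_tsum_rpow (by simp)]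
    simp [hm]

/-- The unitary operator `U` on `L₂(𝕋²)`: `U e_n = eigU n • e_n`. -/
def opU : L2 ≃ₗᵢ[ℂ] L2 :=
  (fourierL2.trans (diag eigU norm_eigU)).trans fourierL2.symm

open Classical in
/-- Multiplication of `u ∈ L₂(𝕋²)` by a function `a` (a continuous one in all uses below; the
value is `0` if the product is not in `L₂`). -/
def mulL2 (a : Torus → ℂ) (u : L2) : L2 :=
  if h : MemLp (fun x => a x * u x) 2 torusMeasure then h.toLp _ else 0

/-! ### The Hilbert Sobolev spaces `H^s(𝕋²)` -/

/-- The weight `(1 + n₁² + n₂²)^{s/2}`. -/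
def weight (s : ℕ) (n : Fin 2 → ℤ) : ℝ :=
  Real.sqrt (1 + (n 0 : ℝ) ^ 2 + (n 1 : ℝ) ^ 2) ^ s

theorem weight_pos (s : ℕ) (n : Fin 2 → ℤ) : 0 < weight s n := by
  unfold weight
  positivity

/-- The functions `u ∈ L₂(𝕋²)` with `∑ₙ (1 + |n|²)^s |û(n)|² < ∞`. -/
def sobolevSubmodule (s : ℕ) : Submodule ℂ L2 where
  carrier := {u | Memℓp (fun n => (weight s n : ℂ) * fourierL2 u n) 2}
  add_mem' {u v} hu hv := by
    have h := Memℓp.add hu hv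
    simp only [mem_ofPred_eq]
    convert h using 1
    funext n
    simp [mul_add]
  zero_mem' := by
    have h : Memℓp (0 : (n : Fin 2 → ℤ) → ℂ) 2 := zero_memℓp
    simp only [mem_ofPred_eq]
    convert h using 1
    funext n
    simp
  smul_mem' c u hu := by
    have h := Memℓp.const_smul hu c
    simp only [mem_ofPred_eq]
    convert h using 1
    funext n
    simp [mul_left_comm]

/-- The Sobolev space `H^s(𝕋²)`, with its norm `(∑ₙ (1 + |n|²)^s |û(n)|²)^{1/2}` (see below). -/
def Sobolev (s : ℕ) : Type := ↥(sobolevSubmodule s)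

namespace Sobolev

instance instAddCommGroup (s : ℕ) : AddCommGroup (Sobolev s) :=
  inferInstanceAs (AddCommGroup ↥(sobolevSubmodule s))

instance instModule (s : ℕ) : Module ℂ (Sobolev s) :=
  inferInstanceAs (Module ℂ ↥(sobolevSubmodule s))

/-- The inclusion of `H^s(𝕋²)` into `L₂(𝕋²)`. -/
def toL2 (s : ℕ) : Sobolev s →ₗ[ℂ] L2 := (sobolevSubmodule s).subtype

/-- The weighted Fourier coefficients `(1 + |n|²)^{s/2} û(n)` of `u ∈ H^s(𝕋²)`. -/
def weightedCoeffs (s : ℕ) : Sobolev s →ₗ[ℂ] Coeffs where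
  toFun u := ⟨fun n => (weight s n : ℂ) * fourierL2 (toL2 s u) n, u.2⟩
  map_add' u v := by
    ext n
    change (weight s n : ℂ) * fourierL2 (toL2 s (u + v)) n
      = (weight s n : ℂ) * fourierL2 (toL2 s u) n + (weight s n : ℂ) * fourierL2 (toL2 s v) n
    simp [mul_add]
  map_smul' c u := by
    ext n
    simp [mul_left_comm]

theorem weightedCoeffs_injective (s : ℕ) : Function.Injective (weightedCoeffs s) := by
  intro u v h
  apply Subtype.ext
  apply fourierL2.injective
  ext n
  have h1 : (weight s n : ℂ) * fourierL2 (toL2 s u) n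
      = (weight s n : ℂ) * fourierL2 (toL2 s v) n :=
    congrFun (congrArg (fun a : Coeffs => (a : (Fin 2 → ℤ) → ℂ)) h) n
  exact mul_left_cancel₀ (Complex.ofReal_ne_zero.mpr (weight_pos s n).ne') h1

instance instNormedAddCommGroup (s : ℕ) : NormedAddCommGroup (Sobolev s) :=
  NormedAddCommGroup.induced (Sobolev s) Coeffs (weightedCoeffs s) (weightedCoeffs_injective s)

instance instNormedSpace (s : ℕ) : NormedSpace ℂ (Sobolev s) :=
  NormedSpace.induced ℂ (Sobolev s) Coeffs (weightedCoeffs s)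

end Sobolev

/-- The family `f` satisfies on `[0,1]` the linear ordinary differential equation
`ḟ = (Id - U ∘ ν)⁻¹ (U ∘ ν̇) f` in the Sobolev space `H^s(𝕋²)`. Here `F t` is `f(·,t)` as an element
of `H^s`; `A t` is the operator `Id - U ∘ ν(·,t)`, required to be a bounded invertible operator on
`H^s` with bounded inverse; `B t` is the operator `U ∘ ν̇(·,t)`, required to be bounded on `H^s`;
and the derivative of `F` is taken in the norm of `H^s`. -/
def SolvesODE (s : ℕ) (ν f : Torus → ℝ → ℂ) : Prop :=
  ∃ (F : ℝ → Sobolev s) (A : ℝ → (Sobolev s ≃L[ℂ] Sobolev s)) (B : ℝ → (Sobolev s →L[ℂ] Sobolev s)),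
    ∀ t ∈ Icc (0 : ℝ) 1,
      (Sobolev.toL2 s (F t) : Torus → ℂ) =ᵐ[torusMeasure] (fun x => f x t) ∧
      (∀ u : Sobolev s, Sobolev.toL2 s (A t u)
        = Sobolev.toL2 s u - opU (mulL2 (fun x => ν x t) (Sobolev.toL2 s u))) ∧
      (∀ u : Sobolev s, Sobolev.toL2 s (B t u)
        = opU (mulL2 (timeDeriv ν t) (Sobolev.toL2 s u))) ∧
      HasDerivWithinAt F ((A t).symm (B t (F t))) (Icc 0 1) t

end TorusBeltrami

end

noncomputable section

namespace TorusBeltrami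

/-! ### Taylor remainders of order two -/

/-! The solution is `f = (Id - U ∘ ν)⁻¹ 1`, that is, `f = 1 + U (ν f)`. Applying `∂_{z̄}` kills the
constant and turns `U` into `∂_z`, which is the Beltrami equation. Since `(Id - U ∘ ν) f = 1`, the
function `f` cannot vanish identically; `ν = 0` gives `f = 1`; and differentiating the inverse
operator in time gives the ODE.

The main point is invertibility on every `H^s`. On `L₂` it is a Neumann series: `U` is unitary and
multiplication by `ν` has norm at most `max |ν| < 1`. In the standard norm of `H^s` multiplication
by `ν` need not be a contraction, so the weight is replaced by `(1 + ε²|n|²)^{s/2}`. For each `ε >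
0` this gives an equivalent norm (`reweight`), in which multiplication differs from its unweighted
version by `O(ε)` (`norm_mulOp_sub_le`). A small `ε` therefore restores the Neumann series
(`isUnit_one_sub_coeffU_mul`).

For smoothness, the Fourier coefficients of `ν` and of its time derivatives decay rapidly, uniformly
in time, so multiplication by `ν` is a smooth curve of operators
(`IsSmoothFamily.contDiffOn_mulOp`), and so is the inverse of `Id - U ∘ ν`. Pairing the resulting
`C^k` curve in `H^{k+3}` with the evaluation functional at `z`, which is `C^k` in `z`
(`contDiff_evalSeries`), gives joint `C^k` regularity for each `k`; the solutions found for
different `s` are one and the same function (`unweight_solCoeffs`). -/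

theorem norm_taylor_remainder_le {E : Type*} [NormedAddCommGroup E] [NormedSpace ℝ E] {S : Set ℝ}
    (hS : Convex ℝ S) {φ φ' φ'' : ℝ → E} (h1 : ∀ t ∈ S, HasDerivWithinAt φ (φ' t) S t)
    (h2 : ∀ t ∈ S, HasDerivWithinAt φ' (φ'' t) S t) {C : ℝ} (hC : ∀ t ∈ S, ‖φ'' t‖ ≤ C)
    {t τ : ℝ} (ht : t ∈ S) (hτ : τ ∈ S) :
    ‖φ τ - φ t - (τ - t) • φ' t‖ ≤ C * |τ - t| ^ 2 := by
  have hC0 : 0 ≤ C := (norm_nonneg _).trans (hC t ht)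
  -- On this smaller convex set `φ'` varies from `φ' t` by at most `C * |τ - t|`; a second mean
  -- value inequality supplies the other factor.
  set K : Set ℝ := S ∩ Metric.closedBall t |τ - t| with hK
  have hKc : Convex ℝ K := hS.inter (convex_closedBall _ _)
  have htK : t ∈ K := ⟨ht, by simp⟩
  have hτK : τ ∈ K := ⟨hτ, by simp [Real.dist_eq]⟩
  have key := hKc.norm_image_sub_le_of_norm_hasDerivWithin_le
    (f := fun σ => φ σ - (σ - t) • φ' t) (f' := fun σ => φ' σ - φ' t) (C := C * |τ - t|)
    (x := t) (y := τ) ?_ ?_ htK hτK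
  · simp only [sub_self, zero_smul, sub_zero, Real.norm_eq_abs] at key
    calc _ = ‖φ τ - (τ - t) • φ' t - φ t‖ := by congr 1; abel
      _ ≤ _ := key
      _ = _ := by ring
  · intro σ hσ
    have hd := ((h1 σ hσ.1).mono (inter_subset_left : K ⊆ S)).sub
      ((((hasDerivAt_id σ).sub_const t).smul_const (φ' t)).hasDerivWithinAt (s := K))
    rw [one_smul] at hd
    exact hd
  · intro σ hσ
    have := hS.norm_image_sub_le_of_norm_hasDerivWithin_le h2 hC ht hσ.1
    refine this.trans (mul_le_mul_of_nonneg_left ?_ hC0)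
    simpa [Real.dist_eq] using hσ.2

/-- Quadratic remainder bounds with a uniform constant survive integration over the torus and
summation over frequencies. This converse to the Taylor estimate then recovers the derivative of the
integral or of the operator series. -/
theorem hasDerivWithinAt_of_remainder_le {E : Type*} [NormedAddCommGroup E] [NormedSpace ℝ E]
    {S : Set ℝ} {φ : ℝ → E} {φ' : E} {C t : ℝ}
    (h : ∀ τ ∈ S, ‖φ τ - φ t - (τ - t) • φ'‖ ≤ C * |τ - t| ^ 2) :
    HasDerivWithinAt φ φ' S t := by
  rw [hasDerivWithinAt_iff_isLittleO]
  have h1 : (fun τ => φ τ - φ t - (τ - t) • φ') =O[nhdsWithin t S] fun τ => (τ - t) ^ 2 := by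
    refine Asymptotics.IsBigO.of_bound C ?_
    filter_upwards [self_mem_nhdsWithin] with τ hτ
    simpa using h τ hτ
  refine h1.trans_isLittleO ?_
  have h2 : (fun τ : ℝ => (τ - t)) =o[nhdsWithin t S] fun _ => (1 : ℝ) := by
    rw [Asymptotics.isLittleO_one_iff]
    have : Filter.Tendsto (fun τ : ℝ => τ - t) (nhds t) (nhds (t - t)) :=
      (continuous_id.sub continuous_const).tendsto t
    rw [sub_self] at this
    exact this.mono_left nhdsWithin_le_nhds
  simpa [pow_two] using h2.mul_isBigO (Asymptotics.isBigO_refl (fun τ : ℝ => τ - t) _)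

/-! ### The covering and the characters -/

theorem proj_add (z w : ℂ) : proj (z + w) = proj z + proj w := by
  ext i
  fin_cases i <;> simp [proj, add_div]

/-- The coordinates `(x₁ / 2π, x₂ / 2π)` on `ℂ`. -/
def scaledCoords : ℂ ≃ₜ (Fin 2 → ℝ) where
  toFun z := ![z.re / (2 * Real.pi), z.im / (2 * Real.pi)]
  invFun v := ⟨v 0 * (2 * Real.pi), v 1 * (2 * Real.pi)⟩
  left_inv z := by
    have := Real.pi_pos.ne'
    apply Complex.ext <;> simp
  right_inv v := by
    have := Real.pi_pos.ne'
    ext i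
    fin_cases i <;> simp
  continuous_toFun := by
    refine continuous_pi fun i => ?_
    fin_cases i
    · exact Complex.continuous_re.div_const _
    · exact Complex.continuous_im.div_const _
  continuous_invFun := by
    have : (fun v : Fin 2 → ℝ => (⟨v 0 * (2 * Real.pi), v 1 * (2 * Real.pi)⟩ : ℂ))
        = fun v => Complex.equivRealProdCLM.symm (v 0 * (2 * Real.pi), v 1 * (2 * Real.pi)) := by
      rfl
    rw [this]
    fun_prop

/-- Openness matters because, unlike the bare quotient property, it persists in the product with
`[0,1]`; continuity on the compact space `𝕋² × [0,1]` can thus be checked in the coordinate `z`. -/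
theorem isOpenQuotientMap_proj : IsOpenQuotientMap proj := by
  have h : IsOpenQuotientMap (fun x : ℝ => (x : UnitAddCircle)) :=
    ⟨Quotient.mk_surjective, AddCircle.continuous_mk' 1, QuotientAddGroup.isOpenMap_coe⟩
  have h2 : IsOpenQuotientMap (Pi.map fun (_ : Fin 2) (x : ℝ) => (x : UnitAddCircle)) :=
    IsOpenQuotientMap.piMap fun _ => h
  have h3 := h2.comp scaledCoords.isOpenQuotientMap
  convert h3 using 1
  funext z i
  fin_cases i <;> rfl

theorem mFourier_apply_add (n : Fin 2 → ℤ) (x y : Torus) :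
    UnitAddTorus.mFourier n (x + y) = UnitAddTorus.mFourier n x * UnitAddTorus.mFourier n y := by
  simp [UnitAddTorus.mFourier, fourier_apply, AddCircle.toCircle_add]
  ring

theorem mFourier_proj (n : Fin 2 → ℤ) (z : ℂ) :
    UnitAddTorus.mFourier n (proj z) = Complex.exp (Complex.I * (n 0 * z.re + n 1 * z.im)) := by
  have : (Real.pi : ℂ) ≠ 0 := by exact_mod_cast Real.pi_pos.ne'
  simp only [UnitAddTorus.mFourier, ContinuousMap.coe_mk, Fin.prod_univ_two, proj,
    Matrix.cons_val_zero, Matrix.cons_val_one, fourier_coe_apply]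
  rw [← Complex.exp_add]
  congr 1
  push_cast
  field_simp

theorem norm_mFourier_apply (n : Fin 2 → ℤ) (x : Torus) : ‖UnitAddTorus.mFourier n x‖ = 1 := by
  simp only [UnitAddTorus.mFourier, fourier_apply, ContinuousMap.coe_mk, norm_prod,
    Circle.norm_coe, Finset.prod_const_one]

/-! ### Fourier coefficients of continuous functions -/

/-- The Fourier coefficient of a function on the torus. -/
def coef (g : Torus → ℂ) (n : Fin 2 → ℤ) : ℂ :=
  ∫ x, UnitAddTorus.mFourier (-n) x * g x ∂torusMeasure

theorem fourierL2_apply (u : L2) (n : Fin 2 → ℤ) : fourierL2 u n = coef u n :=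
  UnitAddTorus.mFourierBasis_repr u n

theorem coef_congr_ae {g h : Torus → ℂ} (hgh : g =ᵐ[torusMeasure] h) (n : Fin 2 → ℤ) :
    coef g n = coef h n :=
  integral_congr_ae (by filter_upwards [hgh] with x hx; rw [hx])

theorem integrable_of_continuous {g : Torus → ℂ} (hg : Continuous g) :
    Integrable g torusMeasure :=
  hg.integrable_of_hasCompactSupport (HasCompactSupport.of_compactSpace g)

theorem integrable_mFourier_mul {g : Torus → ℂ} (hg : Continuous g) (n : Fin 2 → ℤ) :
    Integrable (fun x => UnitAddTorus.mFourier n x * g x) torusMeasure :=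
  integrable_of_continuous (by fun_prop)

theorem norm_coef_le {g : Torus → ℂ} {C : ℝ} (h : ∀ x, ‖g x‖ ≤ C) (n : Fin 2 → ℤ) :
    ‖coef g n‖ ≤ C := by
  have := norm_integral_le_of_norm_le_const (μ := torusMeasure)
    (f := fun x => UnitAddTorus.mFourier (-n) x * g x) (C := C)
    (Filter.Eventually.of_forall fun x => by simpa [norm_mFourier_apply] using h x)
  simpa [coef] using this

theorem coef_sub {g h : Torus → ℂ} (hg : Continuous g) (hh : Continuous h) (n : Fin 2 → ℤ) :
    coef (fun x => g x - h x) n = coef g n - coef h n := by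
  simp only [coef, mul_sub]
  exact integral_sub (integrable_mFourier_mul hg _) (integrable_mFourier_mul hh _)

theorem coef_smul (g : Torus → ℂ) (c : ℝ) (n : Fin 2 → ℤ) :
    coef (fun x => c • g x) n = c • coef g n := by
  simp only [coef, mul_smul_comm]
  exact integral_smul _ _

/-- Invariance of Haar measure. Differentiating this identity in `y` takes the place of integration
by parts. -/
theorem coef_translate (g : Torus → ℂ) (y : Torus) (n : Fin 2 → ℤ) :
    coef (fun x => g (x + y)) n = UnitAddTorus.mFourier n y * coef g n := by
  have h1 : ∀ x, UnitAddTorus.mFourier (-n) x * g (x + y)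
      = UnitAddTorus.mFourier n y * (UnitAddTorus.mFourier (-n) (x + y) * g (x + y)) := by
    intro x
    have h2 : UnitAddTorus.mFourier n y * UnitAddTorus.mFourier (-n) y = 1 := by
      rw [← UnitAddTorus.mFourier_add, add_neg_cancel, UnitAddTorus.mFourier_zero]
      rfl
    rw [mFourier_apply_add]
    linear_combination (-(UnitAddTorus.mFourier (-n) x * g (x + y))) * h2
  simp only [coef, h1]
  rw [integral_const_mul]
  congr 1
  exact integral_add_right_eq_self (μ := torusMeasure)
    (fun x => UnitAddTorus.mFourier (-n) x * g x) y

theorem hasDerivWithinAt_coef {φ : Torus → ℝ → ℂ} {φ' : Torus → ℂ} {S : Set ℝ} {t C : ℝ}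
    (hφ : ∀ τ ∈ S, Continuous fun x => φ x τ) (hφ' : Continuous φ') (ht : t ∈ S)
    (h : ∀ τ ∈ S, ∀ x, ‖φ x τ - φ x t - (τ - t) • φ' x‖ ≤ C * |τ - t| ^ 2) (n : Fin 2 → ℤ) :
    HasDerivWithinAt (fun τ => coef (fun x => φ x τ) n) (coef φ' n) S t := by
  refine hasDerivWithinAt_of_remainder_le (C := C) fun τ hτ => ?_
  have := norm_coef_le (h τ hτ) n
  rwa [coef_sub (g := fun x => φ x τ - φ x t) (h := fun x => (τ - t) • φ' x)
    ((hφ τ hτ).sub (hφ t ht)) (by fun_prop), coef_sub (hφ τ hτ) (hφ t ht), coef_smul] at this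

/-! ### Smooth families -/

/-- The directional derivative of a family along the torus. -/
def dirDeriv (v : ℂ) (g : Torus → ℝ → ℂ) (x : Torus) (t : ℝ) : ℂ :=
  deriv (fun h : ℝ => g (x + proj (h • v)) t) 0

namespace IsSmoothFamily

variable {g : Torus → ℝ → ℂ}

theorem uniqueDiffOn_strip : UniqueDiffOn ℝ ((univ : Set ℂ) ×ˢ Icc (0 : ℝ) 1) :=
  uniqueDiffOn_univ.prod (uniqueDiffOn_Icc zero_lt_one)

theorem continuous_uncurry (hg : IsSmoothFamily g) :
    Continuous fun p : Torus × Icc (0 : ℝ) 1 => g p.1 p.2 := by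
  have hq : IsOpenQuotientMap (Prod.map proj (id : Icc (0 : ℝ) 1 → Icc (0 : ℝ) 1)) :=
    isOpenQuotientMap_proj.prodMap .id
  rw [hq.isQuotientMap.continuous_iff]
  have := hg.continuousOn.comp_continuous (f := fun p : ℂ × Icc (0 : ℝ) 1 => (p.1, (p.2 : ℝ)))
    (by fun_prop) (fun p => ⟨mem_univ _, p.2.2⟩)
  exact this

theorem continuous_slice (hg : IsSmoothFamily g) {t : ℝ} (ht : t ∈ Icc (0 : ℝ) 1) :
    Continuous fun x => g x t :=
  hg.continuous_uncurry.comp (Continuous.prodMk_left (⟨t, ht⟩ : Icc (0 : ℝ) 1))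

theorem exists_bound (hg : IsSmoothFamily g) : ∃ C, ∀ t ∈ Icc (0 : ℝ) 1, ∀ x, ‖g x t‖ ≤ C := by
  obtain ⟨C, hC⟩ := (isCompact_range hg.continuous_uncurry).isBounded.exists_norm_le
  exact ⟨C, fun t ht x => hC _ ⟨(x, ⟨t, ht⟩), rfl⟩⟩

theorem hasFDerivWithinAt (hg : IsSmoothFamily g) (z : ℂ) {t : ℝ} (ht : t ∈ Icc (0 : ℝ) 1) :
    HasFDerivWithinAt (fun p : ℂ × ℝ => g (proj p.1) p.2)
      (fderivWithin ℝ (fun p : ℂ × ℝ => g (proj p.1) p.2) (univ ×ˢ Icc (0 : ℝ) 1) (z, t))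
      (univ ×ˢ Icc (0 : ℝ) 1) (z, t) :=
  (hg.differentiableOn (by simp) (z, t) ⟨mem_univ _, ht⟩).hasFDerivWithinAt

theorem contDiffOn_fderivWithin (hg : IsSmoothFamily g) (v : ℂ × ℝ) :
    ContDiffOn ℝ ∞ (fun p => fderivWithin ℝ (fun p : ℂ × ℝ => g (proj p.1) p.2)
      (univ ×ˢ Icc (0 : ℝ) 1) p v) (univ ×ˢ Icc (0 : ℝ) 1) :=
  (hg.fderivWithin uniqueDiffOn_strip (by simp)).clm_apply contDiffOn_const

theorem hasDerivAt_line (hg : IsSmoothFamily g) (v z : ℂ) {t : ℝ} (ht : t ∈ Icc (0 : ℝ) 1) (h : ℝ) :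
    HasDerivAt (fun h : ℝ => g (proj (z + h • v)) t)
      (fderivWithin ℝ (fun p : ℂ × ℝ => g (proj p.1) p.2) (univ ×ˢ Icc (0 : ℝ) 1)
        (z + h • v, t) (v, 0)) h := by
  have h1 : HasDerivAt (fun h : ℝ => ((z + h • v, t) : ℂ × ℝ)) (v, 0) h := by
    refine HasDerivAt.prodMk ?_ (hasDerivAt_const _ _)
    simpa using ((hasDerivAt_id h).smul_const v).const_add z
  rw [← hasDerivWithinAt_univ] at h1 ⊢
  have h2 : MapsTo (fun h : ℝ => ((z + h • v, t) : ℂ × ℝ)) univ (univ ×ˢ Icc (0 : ℝ) 1) :=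
    fun _ _ => ⟨mem_univ _, ht⟩
  exact (hg.hasFDerivWithinAt (z + h • v) ht).comp_hasDerivWithinAt h h1 h2

theorem dirDeriv_proj (hg : IsSmoothFamily g) (v z : ℂ) {t : ℝ} (ht : t ∈ Icc (0 : ℝ) 1) :
    dirDeriv v g (proj z) t
      = fderivWithin ℝ (fun p : ℂ × ℝ => g (proj p.1) p.2) (univ ×ˢ Icc (0 : ℝ) 1) (z, t) (v, 0) := by
  have h := (hg.hasDerivAt_line v z ht 0).deriv
  simp only [zero_smul, add_zero] at h
  rw [← h]
  simp only [dirDeriv, ← proj_add]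

theorem hasDerivAt_dirDeriv (hg : IsSmoothFamily g) (v : ℂ) (x : Torus) {t : ℝ}
    (ht : t ∈ Icc (0 : ℝ) 1) (h : ℝ) :
    HasDerivAt (fun h : ℝ => g (x + proj (h • v)) t) (dirDeriv v g (x + proj (h • v)) t) h := by
  obtain ⟨z, rfl⟩ := isOpenQuotientMap_proj.surjective x
  simp only [← proj_add]
  rw [hg.dirDeriv_proj v _ ht]
  exact hg.hasDerivAt_line v z ht h

theorem dirDeriv (hg : IsSmoothFamily g) (v : ℂ) : IsSmoothFamily (dirDeriv v g) :=
  (hg.contDiffOn_fderivWithin (v, 0)).congr fun p hp => hg.dirDeriv_proj v p.1 hp.2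

theorem hasDerivWithinAt_line (hg : IsSmoothFamily g) (z : ℂ) {t : ℝ} (ht : t ∈ Icc (0 : ℝ) 1) :
    HasDerivWithinAt (fun τ => g (proj z) τ)
      (fderivWithin ℝ (fun p : ℂ × ℝ => g (proj p.1) p.2) (univ ×ˢ Icc (0 : ℝ) 1) (z, t) (0, 1))
      (Icc 0 1) t := by
  have h1 : HasDerivWithinAt (fun τ : ℝ => ((z, τ) : ℂ × ℝ)) (0, 1) (Icc 0 1) t :=
    (hasDerivWithinAt_const _ _ _).prodMk (hasDerivWithinAt_id _ _)
  have h2 : MapsTo (fun τ : ℝ => ((z, τ) : ℂ × ℝ)) (Icc 0 1) (univ ×ˢ Icc (0 : ℝ) 1) :=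
    fun _ h => ⟨mem_univ _, h⟩
  exact (hg.hasFDerivWithinAt z ht).comp_hasDerivWithinAt t h1 h2

theorem timeDeriv_proj (hg : IsSmoothFamily g) (z : ℂ) {t : ℝ} (ht : t ∈ Icc (0 : ℝ) 1) :
    timeDeriv g t (proj z)
      = fderivWithin ℝ (fun p : ℂ × ℝ => g (proj p.1) p.2) (univ ×ˢ Icc (0 : ℝ) 1) (z, t) (0, 1) :=
  (hg.hasDerivWithinAt_line z ht).derivWithin (uniqueDiffOn_Icc zero_lt_one t ht)

theorem hasDerivWithinAt_timeDeriv (hg : IsSmoothFamily g) (x : Torus) {t : ℝ}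
    (ht : t ∈ Icc (0 : ℝ) 1) :
    HasDerivWithinAt (fun τ => g x τ) (timeDeriv g t x) (Icc 0 1) t := by
  obtain ⟨z, rfl⟩ := isOpenQuotientMap_proj.surjective x
  rw [hg.timeDeriv_proj z ht]
  exact hg.hasDerivWithinAt_line z ht

theorem timeDeriv (hg : IsSmoothFamily g) : IsSmoothFamily fun x t => timeDeriv g t x :=
  (hg.contDiffOn_fderivWithin (0, 1)).congr fun p hp => hg.timeDeriv_proj p.1 hp.2

theorem sub {h : Torus → ℝ → ℂ} (hg : IsSmoothFamily g) (hh : IsSmoothFamily h) :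
    IsSmoothFamily fun x t => g x t - h x t :=
  ContDiffOn.sub hg hh

/-- The coefficient of the translate by `h • v` is differentiated at `h = 0` in two ways: under the
integral, with the second directional derivative controlling the remainder, and through the explicit
factor `exp (i h (n, v))`. Uniqueness of the derivative identifies the results. -/
theorem coef_dirDeriv (hg : IsSmoothFamily g) (v : ℂ) {t : ℝ} (ht : t ∈ Icc (0 : ℝ) 1)
    (n : Fin 2 → ℤ) :
    coef (fun x => TorusBeltrami.dirDeriv v g x t) n
      = Complex.I * (n 0 * v.re + n 1 * v.im) * coef (fun x => g x t) n := by
  obtain ⟨C, hC⟩ := ((hg.dirDeriv v).dirDeriv v).exists_bound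
  have h1 := hasDerivWithinAt_coef (φ := fun x h => g (x + proj (h • v)) t)
    (φ' := fun x => TorusBeltrami.dirDeriv v g x t) (S := univ) (t := 0) (C := C)
    (fun h _ => (hg.continuous_slice ht).comp (by fun_prop))
    ((hg.dirDeriv v).continuous_slice ht) (mem_univ _) (fun τ hτ x => by
      have := norm_taylor_remainder_le convex_univ
        (fun h _ => (hg.hasDerivAt_dirDeriv v x ht h).hasDerivWithinAt)
        (fun h _ => ((hg.dirDeriv v).hasDerivAt_dirDeriv v x ht h).hasDerivWithinAt)
        (fun h _ => hC t ht _) (mem_univ 0) (mem_univ τ)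
      have h0 : proj 0 = 0 := by
        have := proj_add 0 0
        simpa using this
      simpa [h0] using this) n
  have h2 : ∀ h : ℝ, coef (fun x => g (x + proj (h • v)) t) n
      = Complex.exp (Complex.I * (n 0 * v.re + n 1 * v.im) * h) * coef (fun x => g x t) n := by
    intro h
    rw [coef_translate (fun x => g x t), mFourier_proj]
    congr 2
    simp
    ring
  simp only [h2] at h1
  rw [hasDerivWithinAt_univ] at h1
  have h3 : HasDerivAt (fun h : ℝ => Complex.exp (Complex.I * (n 0 * v.re + n 1 * v.im) * h)
      * coef (fun x => g x t) n)
      (Complex.I * (n 0 * v.re + n 1 * v.im) * coef (fun x => g x t) n) 0 := by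
    have h4 : HasDerivAt (fun h : ℝ => Complex.I * (n 0 * v.re + n 1 * v.im) * (h : ℂ))
        (Complex.I * (n 0 * v.re + n 1 * v.im)) 0 := by
      simpa using (Complex.ofRealCLM.hasDerivAt (x := 0)).const_mul
        (Complex.I * (n 0 * v.re + n 1 * v.im))
    simpa using h4.cexp.mul_const (coef (fun x => g x t) n)
  exact h1.unique h3

theorem hasDerivWithinAt_coef (hg : IsSmoothFamily g) {t : ℝ} (ht : t ∈ Icc (0 : ℝ) 1)
    (n : Fin 2 → ℤ) :
    HasDerivWithinAt (fun τ => coef (fun x => g x τ) n)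
      (coef (TorusBeltrami.timeDeriv g t) n) (Icc 0 1) t := by
  obtain ⟨C, hC⟩ := hg.timeDeriv.timeDeriv.exists_bound
  exact TorusBeltrami.hasDerivWithinAt_coef (fun τ hτ => hg.continuous_slice hτ)
    (hg.timeDeriv.continuous_slice ht) ht (fun τ hτ x =>
      norm_taylor_remainder_le (convex_Icc 0 1)
        (fun σ hσ => hg.hasDerivWithinAt_timeDeriv x hσ)
        (fun σ hσ => hg.timeDeriv.hasDerivWithinAt_timeDeriv x hσ)
        (fun σ hσ => hC σ hσ x) ht hτ) n

/-- Fourier coefficients of a smooth family decay rapidly, uniformly in time. -/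
theorem exists_coef_bound (N : ℕ) : ∀ {g : Torus → ℝ → ℂ}, IsSmoothFamily g →
    ∃ C, ∀ t ∈ Icc (0 : ℝ) 1, ∀ n : Fin 2 → ℤ,
      (1 + (n 0 : ℝ) ^ 2 + (n 1 : ℝ) ^ 2) ^ N * ‖coef (fun x => g x t) n‖ ≤ C := by
  induction N with
  | zero =>
    intro g hg
    obtain ⟨C, hC⟩ := hg.exists_bound
    exact ⟨C, fun t ht n => by simpa using norm_coef_le (hC t ht) n⟩
  | succ N ih =>
    intro g hg
    -- Subtracting both second derivatives from `g` multiplies the `n`-th coefficient by `1 + |n|²`,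
    -- which is one more power.
    have h1 := (hg.dirDeriv 1).dirDeriv 1
    have h2 := (hg.dirDeriv Complex.I).dirDeriv Complex.I
    obtain ⟨C, hC⟩ := ih ((hg.sub h1).sub h2)
    refine ⟨C, fun t ht n => (le_of_eq ?_).trans (hC t ht n)⟩
    rw [coef_sub ((hg.sub h1).continuous_slice ht) (h2.continuous_slice ht),
      coef_sub (hg.continuous_slice ht) (h1.continuous_slice ht), (hg.dirDeriv 1).coef_dirDeriv 1 ht,
      hg.coef_dirDeriv 1 ht, (hg.dirDeriv _).coef_dirDeriv _ ht, hg.coef_dirDeriv _ ht]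
    have h3 : coef (fun x => g x t) n - Complex.I * (n 0 * (1 : ℂ).re + n 1 * (1 : ℂ).im)
          * (Complex.I * (n 0 * (1 : ℂ).re + n 1 * (1 : ℂ).im) * coef (fun x => g x t) n)
        - Complex.I * (n 0 * Complex.I.re + n 1 * Complex.I.im)
          * (Complex.I * (n 0 * Complex.I.re + n 1 * Complex.I.im) * coef (fun x => g x t) n)
        = ((1 + (n 0 : ℝ) ^ 2 + (n 1 : ℝ) ^ 2 : ℝ) : ℂ) * coef (fun x => g x t) n := by
      have hI := Complex.I_sq
      simp only [Complex.one_re, Complex.one_im, Complex.I_re, Complex.I_im]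
      push_cast
      linear_combination (-((n 0 : ℂ) ^ 2 + (n 1 : ℂ) ^ 2) * coef (fun x => g x t) n) * hI
    rw [h3, norm_mul, Complex.norm_real, Real.norm_of_nonneg (by positivity)]
    ring

end IsSmoothFamily

/-! ### Weighted shifts of square summable families -/

theorem coeffs_norm_sq (c : Coeffs) : HasSum (fun n => ‖c n‖ ^ 2) (‖c‖ ^ 2) := by
  have := lp.hasSum_norm (p := 2) (by simp) c
  simpa using this

theorem memℓp_two_of_sq_le {b c : (Fin 2 → ℤ) → ℂ} {C : ℝ} (hc : Summable fun n => ‖c n‖ ^ 2)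
    (h : ∀ n, ‖b n‖ ≤ C * ‖c n‖) : Memℓp b 2 := by
  refine memℓp_gen ?_
  refine Summable.of_nonneg_of_le (fun n => by positivity) (fun n => ?_) (hc.mul_left (C ^ 2))
  have := pow_le_pow_left₀ (norm_nonneg _) (h n) 2
  rw [mul_pow] at this
  simpa using this

theorem coeffs_norm_le {b : Coeffs} {c : (Fin 2 → ℤ) → ℂ} {C R : ℝ} (hC : 0 ≤ C) (hR : 0 ≤ R)
    (hc : HasSum (fun n => ‖c n‖ ^ 2) (R ^ 2)) (h : ∀ n, ‖b n‖ ≤ C * ‖c n‖) :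
    ‖b‖ ≤ C * R := by
  refine le_of_sq_le_sq ?_ (by positivity)
  rw [mul_pow]
  refine hasSum_le (fun n => ?_) (coeffs_norm_sq b) (hc.mul_left (C ^ 2))
  have := pow_le_pow_left₀ (norm_nonneg _) (h n) 2
  rwa [mul_pow] at this

theorem hasSum_shift (c : Coeffs) (j : Fin 2 → ℤ) :
    HasSum (fun n => ‖c (n - j)‖ ^ 2) (‖c‖ ^ 2) :=
  (Equiv.subRight j).hasSum_iff.mpr (coeffs_norm_sq c)

/-- The operator `c ↦ (n ↦ m n * c (n - j))`, for a bounded multiplier `m`. -/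
def weightedShift (m : (Fin 2 → ℤ) → ℂ) (C : ℝ) (hm : ∀ n, ‖m n‖ ≤ C) (j : Fin 2 → ℤ) :
    Coeffs →L[ℂ] Coeffs :=
  LinearMap.mkContinuous
    { toFun := fun c => ⟨fun n => m n * c (n - j),
        memℓp_two_of_sq_le (hasSum_shift c j).summable fun n => by
          rw [norm_mul]
          exact mul_le_mul_of_nonneg_right (hm n) (norm_nonneg _)⟩
      map_add' := fun a b => by
        ext n
        exact mul_add _ _ _
      map_smul' := fun c a => by
        ext n
        simp [mul_left_comm] }
    C (fun c => coeffs_norm_le ((norm_nonneg _).trans (hm 0)) (norm_nonneg _) (hasSum_shift c j)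
      fun n => by
        simp only [LinearMap.coe_mk, AddHom.coe_mk, norm_mul]
        exact mul_le_mul_of_nonneg_right (hm n) (norm_nonneg _))

theorem weightedShift_apply (m : (Fin 2 → ℤ) → ℂ) (C : ℝ) (hm : ∀ n, ‖m n‖ ≤ C) (j : Fin 2 → ℤ)
    (c : Coeffs) (n : Fin 2 → ℤ) : weightedShift m C hm j c n = m n * c (n - j) := rfl

theorem norm_weightedShift_le (m : (Fin 2 → ℤ) → ℂ) (C : ℝ) (hm : ∀ n, ‖m n‖ ≤ C)
    (j : Fin 2 → ℤ) : ‖weightedShift m C hm j‖ ≤ C :=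
  LinearMap.mkContinuous_norm_le _ ((norm_nonneg _).trans (hm 0)) _

/-- The evaluation of a coefficient. -/
def evalCoeff (n : Fin 2 → ℤ) : Coeffs →L[ℂ] ℂ :=
  LinearMap.mkContinuous
    { toFun := fun c => c n
      map_add' := fun _ _ => rfl
      map_smul' := fun _ _ => rfl } 1 (fun c => by
      rw [one_mul]
      exact lp.norm_apply_le_norm (by simp) c n)

theorem evalCoeff_apply (n : Fin 2 → ℤ) (c : Coeffs) : evalCoeff n c = c n := rfl

theorem norm_evalCoeff_le (n : Fin 2 → ℤ) : ‖evalCoeff n‖ ≤ 1 :=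
  LinearMap.mkContinuous_norm_le _ zero_le_one _

/-! ### The scaled brackets -/

/-- The scaled bracket `(1 + ε² |n|²)^{1/2}`. -/
def bracket (ε : ℝ) (n : Fin 2 → ℤ) : ℝ :=
  Real.sqrt (1 + (ε * n 0) ^ 2 + (ε * n 1) ^ 2)

theorem weight_eq (s : ℕ) (n : Fin 2 → ℤ) : weight s n = bracket 1 n ^ s := by
  simp [weight, bracket]

theorem one_le_bracket (ε : ℝ) (n : Fin 2 → ℤ) : 1 ≤ bracket ε n := by
  rw [bracket, Real.one_le_sqrt]
  nlinarith [sq_nonneg (ε * n 0), sq_nonneg (ε * n 1)]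

theorem bracket_pos (ε : ℝ) (n : Fin 2 → ℤ) : 0 < bracket ε n :=
  zero_lt_one.trans_le (one_le_bracket ε n)

theorem bracket_ne_zero (ε : ℝ) (n : Fin 2 → ℤ) : (bracket ε n : ℂ) ≠ 0 :=
  Complex.ofReal_ne_zero.mpr (bracket_pos ε n).ne'

theorem bracket_zero (n : Fin 2 → ℤ) : bracket 0 n = 1 := by simp [bracket]

/-- The bracket is the Euclidean norm of `(1, ε n₁, ε n₂)`, so this is the triangle inequality. -/
theorem bracket_le_add (ε : ℝ) (m j : Fin 2 → ℤ) :
    bracket ε (m + j) ≤ bracket ε m + |ε| * bracket 1 j := by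
  have h1 : ∀ n : Fin 2 → ℤ,
      bracket ε n = ‖(!₂[1, ε * n 0, ε * n 1] : EuclideanSpace ℝ (Fin 3))‖ := by
    intro n
    simp [bracket, EuclideanSpace.norm_eq, Fin.sum_univ_three]
  have h2 : (!₂[1, ε * (m + j) 0, ε * (m + j) 1] : EuclideanSpace ℝ (Fin 3))
      = !₂[1, ε * m 0, ε * m 1] + !₂[0, ε * j 0, ε * j 1] := by
    ext i
    fin_cases i <;> simp [mul_add]
  have h3 : ‖(!₂[0, ε * j 0, ε * j 1] : EuclideanSpace ℝ (Fin 3))‖ ≤ |ε| * bracket 1 j := by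
    rw [← Real.sqrt_sq_eq_abs, bracket, ← Real.sqrt_mul (sq_nonneg _)]
    simp only [EuclideanSpace.norm_eq, Fin.sum_univ_three]
    refine Real.sqrt_le_sqrt ?_
    simp [mul_pow]
    nlinarith [sq_nonneg ε]
  rw [h1, h1, h2]
  exact (norm_add_le _ _).trans (add_le_add_right h3 _)

theorem bracket_neg (ε : ℝ) (n : Fin 2 → ℤ) : bracket ε (-n) = bracket ε n := by
  simp [bracket]

/-- The source of the small factor: a shift by `j` changes the scaled bracket by at most `|ε| *
bracket 1 j`, uniformly in `n`, and the denominator is at least `1`. -/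
theorem abs_bracket_div_sub_one_le (ε : ℝ) (n j : Fin 2 → ℤ) :
    |bracket ε n / bracket ε (n - j) - 1| ≤ |ε| * bracket 1 j := by
  have h1 := bracket_le_add ε (n - j) j
  have h2 := bracket_le_add ε n (-j)
  rw [sub_add_cancel] at h1
  rw [← sub_eq_add_neg, bracket_neg] at h2
  have h3 := bracket_pos ε (n - j)
  have h4 := one_le_bracket ε (n - j)
  rw [div_sub_one h3.ne', abs_div, abs_of_pos h3, div_le_iff₀ h3]
  have h5 : 0 ≤ |ε| * bracket 1 j := by
    have := bracket_pos 1 j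
    positivity
  calc _ ≤ |ε| * bracket 1 j := abs_le.mpr ⟨by linarith, by linarith⟩
    _ ≤ _ := le_mul_of_one_le_right h5 h4

theorem abs_pow_le_of_abs_sub_one_le {r d : ℝ} (h : |r - 1| ≤ d) (s : ℕ) : |r ^ s| ≤ (1 + d) ^ s := by
  rw [abs_pow]
  refine pow_le_pow_left₀ (abs_nonneg _) ?_ s
  have := abs_add_le (r - 1) 1
  rw [sub_add_cancel, abs_one] at this
  linarith

/-- Keeps one factor `ε` in front, while the growth in `d` is left to the weight `(1 + d) ^ s` of
the summability condition. -/
theorem abs_pow_sub_one_le {r ε d : ℝ} (hε : 0 ≤ ε) (hε1 : ε ≤ 1) (hd : 0 ≤ d)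
    (h : |r - 1| ≤ ε * d) (s : ℕ) : |r ^ s - 1| ≤ ε * (1 + d) ^ s := by
  induction s with
  | zero => simpa using hε
  | succ s ih =>
    have h1 : |r ^ s| ≤ (1 + d) ^ s :=
      abs_pow_le_of_abs_sub_one_le (h.trans (mul_le_of_le_one_left hd hε1)) s
    calc |r ^ (s + 1) - 1| = |r ^ s * (r - 1) + (r ^ s - 1)| := by ring_nf
      _ ≤ |r ^ s| * |r - 1| + |r ^ s - 1| := by
        rw [← abs_mul]
        exact abs_add_le _ _
      _ ≤ (1 + d) ^ s * (ε * d) + ε * (1 + d) ^ s :=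
        add_le_add (mul_le_mul h1 h (abs_nonneg _) (by positivity)) ih
      _ = _ := by ring

/-! ### Multiplication by a function, on weighted Fourier coefficients -/

/-- Multiplication by the character `e_j`, on coefficients with the weight `bracket ε ^ s`. -/
def mulShift (ε : ℝ) (s : ℕ) (j : Fin 2 → ℤ) : Coeffs →L[ℂ] Coeffs :=
  weightedShift (fun n => ((bracket ε n / bracket ε (n - j)) ^ s : ℝ))
    ((1 + |ε| * bracket 1 j) ^ s) (fun n => by
      rw [Complex.norm_real]
      exact abs_pow_le_of_abs_sub_one_le (abs_bracket_div_sub_one_le ε n j) s) j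

theorem mulShift_apply (ε : ℝ) (s : ℕ) (j : Fin 2 → ℤ) (c : Coeffs) (n : Fin 2 → ℤ) :
    mulShift ε s j c n = (bracket ε n / bracket ε (n - j) : ℂ) ^ s * c (n - j) := by
  rw [mulShift, weightedShift_apply]
  push_cast
  rfl

theorem norm_mulShift_le {ε : ℝ} (hε : 0 ≤ ε) (hε1 : ε ≤ 1) (s : ℕ) (j : Fin 2 → ℤ) :
    ‖mulShift ε s j‖ ≤ (1 + bracket 1 j) ^ s := by
  have := bracket_pos 1 j
  refine (norm_weightedShift_le _ _ _ _).trans (pow_le_pow_left₀ (by positivity) ?_ s)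
  rw [abs_of_nonneg hε]
  have := mul_le_of_le_one_left this.le hε1
  linarith

/-- At `ε = 0` all weights are `1` and the operator is the plain shift, so the difference is the
shift with multiplier `r ^ s - 1`, where `r` is the ratio of brackets. -/
theorem norm_mulShift_sub_le {ε : ℝ} (hε : 0 ≤ ε) (hε1 : ε ≤ 1) (s : ℕ) (j : Fin 2 → ℤ) :
    ‖mulShift ε s j - mulShift 0 s j‖ ≤ ε * (1 + bracket 1 j) ^ s := by
  have hb := bracket_pos 1 j
  refine ContinuousLinearMap.opNorm_le_bound _ (by positivity) fun c => ?_
  refine coeffs_norm_le (by positivity) (norm_nonneg _) (hasSum_shift c j) fun n => ?_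
  have h1 : (mulShift ε s j - mulShift 0 s j) c n
      = (((bracket ε n / bracket ε (n - j)) ^ s - 1 : ℝ) : ℂ) * c (n - j) := by
    change mulShift ε s j c n - mulShift 0 s j c n = _
    rw [mulShift_apply, mulShift_apply, bracket_zero, bracket_zero]
    push_cast
    simp [sub_mul]
  rw [h1, norm_mul, Complex.norm_real]
  refine mul_le_mul_of_nonneg_right ?_ (norm_nonneg _)
  refine abs_pow_sub_one_le hε hε1 hb.le ?_ s
  have := abs_bracket_div_sub_one_le ε n j
  rwa [abs_of_nonneg hε] at this

/-- Multiplication by the function with Fourier coefficients `a`, on coefficients with the weight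
`bracket ε ^ s`. -/
def mulOp (ε : ℝ) (s : ℕ) (a : (Fin 2 → ℤ) → ℂ) : Coeffs →L[ℂ] Coeffs :=
  ∑' j, a j • mulShift ε s j

/-- The coefficients `a` are summable with the weight `(1 + ⟨j⟩)^s`. -/
def WeightedSummable (s : ℕ) (a : (Fin 2 → ℤ) → ℂ) : Prop :=
  Summable fun j => ‖a j‖ * (1 + bracket 1 j) ^ s

section

variable {ε : ℝ} {s : ℕ} {a : (Fin 2 → ℤ) → ℂ}

theorem norm_smul_mulShift_le (hε : 0 ≤ ε) (hε1 : ε ≤ 1) (j : Fin 2 → ℤ) :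
    ‖a j • mulShift ε s j‖ ≤ ‖a j‖ * (1 + bracket 1 j) ^ s := by
  rw [norm_smul]
  exact mul_le_mul_of_nonneg_left (norm_mulShift_le hε hε1 s j) (norm_nonneg _)

theorem summable_mulShift (hε : 0 ≤ ε) (hε1 : ε ≤ 1) (ha : WeightedSummable s a) :
    Summable fun j => a j • mulShift ε s j :=
  Summable.of_norm_bounded ha (norm_smul_mulShift_le hε hε1)

theorem norm_mulOp_le (hε : 0 ≤ ε) (hε1 : ε ≤ 1) (ha : WeightedSummable s a) :
    ‖mulOp ε s a‖ ≤ ∑' j, ‖a j‖ * (1 + bracket 1 j) ^ s :=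
  tsum_of_norm_bounded ha.hasSum (norm_smul_mulShift_le hε hε1)

theorem norm_mulOp_sub_le (hε : 0 ≤ ε) (hε1 : ε ≤ 1) (ha : WeightedSummable s a) :
    ‖mulOp ε s a - mulOp 0 s a‖ ≤ ε * ∑' j, ‖a j‖ * (1 + bracket 1 j) ^ s := by
  rw [mulOp, mulOp, ← (summable_mulShift hε hε1 ha).tsum_sub
    (summable_mulShift le_rfl zero_le_one ha)]
  refine tsum_of_norm_bounded (ha.hasSum.mul_left ε) fun j => ?_
  rw [← smul_sub, norm_smul, mul_left_comm]
  exact mul_le_mul_of_nonneg_left (norm_mulShift_sub_le hε hε1 s j) (norm_nonneg _)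

theorem hasSum_mulOp_apply (hε : 0 ≤ ε) (hε1 : ε ≤ 1) (ha : WeightedSummable s a) (c : Coeffs)
    (n : Fin 2 → ℤ) :
    HasSum (fun j => a j * ((bracket ε n / bracket ε (n - j) : ℂ) ^ s * c (n - j)))
      (mulOp ε s a c n) := by
  have h1 := (summable_mulShift hε hε1 ha).hasSum.mapL
    ((evalCoeff n).comp (ContinuousLinearMap.apply ℂ Coeffs c))
  refine h1.congr_fun fun j => ?_
  simp only [ContinuousLinearMap.comp_apply, ContinuousLinearMap.apply_apply, evalCoeff_apply]
  rw [← mulShift_apply]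
  rfl

end

/-! ### The operator `U` on Fourier coefficients -/

/-- The operator `U` on Fourier coefficients (weighted or not). -/
def coeffU : Coeffs →L[ℂ] Coeffs :=
  (diag eigU norm_eigU).toContinuousLinearEquiv.toContinuousLinearMap

theorem coeffU_apply (c : Coeffs) (n : Fin 2 → ℤ) : coeffU c n = eigU n * c n := rfl

theorem norm_coeffU_le : ‖coeffU‖ ≤ 1 :=
  ContinuousLinearMap.opNorm_le_bound _ zero_le_one fun c => by
    rw [one_mul]
    exact ((diag eigU norm_eigU).norm_map c).le

theorem fourierL2_opU (u : L2) : fourierL2 (opU u) = coeffU (fourierL2 u) := by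
  simp [opU, coeffU]

/-! ### Invertibility of `Id - U ∘ ν` -/

theorem bracket_div_le_inv {ε : ℝ} (hε : 0 < ε) (hε1 : ε ≤ 1) (n : Fin 2 → ℤ) :
    bracket 1 n / bracket ε n ≤ ε⁻¹ := by
  rw [div_le_iff₀ (bracket_pos _ _), inv_mul_eq_div, le_div_iff₀ hε, mul_comm]
  nth_rw 1 [← Real.sqrt_sq hε.le]
  rw [bracket, ← Real.sqrt_mul (sq_nonneg _), bracket]
  refine Real.sqrt_le_sqrt ?_
  nlinarith

theorem bracket_div_le_one {ε : ℝ} (hε : 0 < ε) (hε1 : ε ≤ 1) (n : Fin 2 → ℤ) :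
    bracket ε n / bracket 1 n ≤ 1 := by
  rw [div_le_one (bracket_pos _ _)]
  refine Real.sqrt_le_sqrt ?_
  have h1 : ε ^ 2 ≤ 1 := pow_le_one₀ hε.le hε1
  nlinarith [mul_le_mul_of_nonneg_right h1 (sq_nonneg (n 0 : ℝ)),
    mul_le_mul_of_nonneg_right h1 (sq_nonneg (n 1 : ℝ))]

/-- The change of weight from `bracket ε ^ s` to `bracket 1 ^ s`. -/
def reweight {ε : ℝ} (hε : 0 < ε) (hε1 : ε ≤ 1) (s : ℕ) : (Coeffs →L[ℂ] Coeffs)ˣ where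
  val := weightedShift (fun n => ((bracket 1 n / bracket ε n) ^ s : ℝ)) (ε⁻¹ ^ s) (fun n => by
    have h1 := bracket_pos 1 n
    have h2 := bracket_pos ε n
    rw [Complex.norm_real, Real.norm_of_nonneg (by positivity)]
    exact pow_le_pow_left₀ (by positivity) (bracket_div_le_inv hε hε1 n) s) 0
  inv := weightedShift (fun n => ((bracket ε n / bracket 1 n) ^ s : ℝ)) 1 (fun n => by
    have h1 := bracket_pos 1 n
    have h2 := bracket_pos ε n
    rw [Complex.norm_real, Real.norm_of_nonneg (by positivity)]
    exact pow_le_one₀ (by positivity) (bracket_div_le_one hε hε1 n)) 0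
  val_inv := by
    ext c n
    have h1 := bracket_ne_zero 1 n
    have h2 := bracket_ne_zero ε n
    simp only [mul_apply_eq_comp, weightedShift_apply, sub_zero,
      one_apply_eq_self]
    push_cast
    rw [← mul_assoc, ← mul_pow, div_mul_div_cancel₀ h2, div_self h1, one_pow, one_mul]
  inv_val := by
    ext c n
    have h1 := bracket_ne_zero 1 n
    have h2 := bracket_ne_zero ε n
    simp only [mul_apply_eq_comp, weightedShift_apply, sub_zero,
      one_apply_eq_self]
    push_cast
    rw [← mul_assoc, ← mul_pow, div_mul_div_cancel₀ h1, div_self h2, one_pow, one_mul]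

theorem reweight_apply {ε : ℝ} (hε : 0 < ε) (hε1 : ε ≤ 1) (s : ℕ) (c : Coeffs) (n : Fin 2 → ℤ) :
    (reweight hε hε1 s : Coeffs →L[ℂ] Coeffs) c n = (bracket 1 n / bracket ε n : ℂ) ^ s * c n := by
  change (((bracket 1 n / bracket ε n) ^ s : ℝ) : ℂ) * c (n - 0) = _
  push_cast
  rw [sub_zero]

/-- The ratios of brackets telescope: the operators for `ε` and for `1` express the same
multiplication in two weights. -/
theorem reweight_mul_mulShift {ε : ℝ} (hε : 0 < ε) (hε1 : ε ≤ 1) (s : ℕ) (j : Fin 2 → ℤ) :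
    (reweight hε hε1 s : Coeffs →L[ℂ] Coeffs) * mulShift ε s j
      = mulShift 1 s j * reweight hε hε1 s := by
  ext c n
  have h1 := bracket_ne_zero 1 (n - j)
  have h2 := bracket_ne_zero ε n
  simp only [mul_apply_eq_comp, reweight_apply, mulShift_apply]
  rw [← mul_assoc, ← mul_assoc, ← mul_pow, ← mul_pow, div_mul_div_cancel₀ h2,
    div_mul_div_cancel₀ h1]

theorem reweight_mul_coeffU {ε : ℝ} (hε : 0 < ε) (hε1 : ε ≤ 1) (s : ℕ) :
    (reweight hε hε1 s : Coeffs →L[ℂ] Coeffs) * coeffU = coeffU * reweight hε hε1 s := by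
  ext c n
  simp only [mul_apply_eq_comp, reweight_apply, coeffU_apply]
  ring

theorem reweight_mul_mulOp {ε : ℝ} (hε : 0 < ε) (hε1 : ε ≤ 1) {s : ℕ} {a : (Fin 2 → ℤ) → ℂ}
    (ha : WeightedSummable s a) :
    (reweight hε hε1 s : Coeffs →L[ℂ] Coeffs) * mulOp ε s a = mulOp 1 s a * reweight hε hε1 s := by
  rw [mulOp, mulOp, ← (summable_mulShift hε.le hε1 ha).tsum_mul_left,
    ← (summable_mulShift zero_le_one le_rfl ha).tsum_mul_right]
  simp only [mul_smul_comm, smul_mul_assoc, reweight_mul_mulShift]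

/-- Strict contractivity without weights persists in the `ε`-weighted norm for small `ε`. The
Neumann series converges there, and conjugation by `reweight` carries invertibility back to the
standard weight. -/
theorem isUnit_one_sub_coeffU_mul {s : ℕ} {a : (Fin 2 → ℤ) → ℂ} (ha : WeightedSummable s a)
    (h : ‖mulOp 0 s a‖ < 1) : IsUnit (1 - coeffU * mulOp 1 s a) := by
  set B : ℝ := ∑' j, ‖a j‖ * (1 + bracket 1 j) ^ s
  have hB : 0 ≤ B := tsum_nonneg fun j => by
    have := bracket_pos 1 j
    positivity
  obtain ⟨ε, hε, hε1, hεB⟩ : ∃ ε : ℝ, 0 < ε ∧ ε ≤ 1 ∧ ‖mulOp 0 s a‖ + ε * B < 1 := by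
    -- The perturbation may use at most half of the gap below `1`; `B + 1` keeps the denominator
    -- positive when `B = 0`.
    refine ⟨min 1 ((1 - ‖mulOp 0 s a‖) / (2 * (B + 1))), ?_, min_le_left _ _, ?_⟩
    · exact lt_min zero_lt_one (div_pos (by linarith) (by positivity))
    · have h1 : min 1 ((1 - ‖mulOp 0 s a‖) / (2 * (B + 1))) * B
          ≤ (1 - ‖mulOp 0 s a‖) / (2 * (B + 1)) * B :=
        mul_le_mul_of_nonneg_right (min_le_right _ _) hB
      have h2 : (1 - ‖mulOp 0 s a‖) / (2 * (B + 1)) * B ≤ (1 - ‖mulOp 0 s a‖) / 2 := by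
        rw [div_mul_eq_mul_div, div_le_div_iff₀ (by positivity) (by positivity)]
        nlinarith
      linarith
  have h1 : ‖mulOp ε s a‖ < 1 := by
    have h2 := norm_add_le (mulOp 0 s a) (mulOp ε s a - mulOp 0 s a)
    rw [add_sub_cancel] at h2
    linarith [norm_mulOp_sub_le hε.le hε1 ha]
  have h2 : IsUnit (1 - coeffU * mulOp ε s a) := by
    refine isUnit_one_sub_of_norm_lt_one ((norm_mul_le _ _).trans_lt ?_)
    exact (mul_le_of_le_one_left (norm_nonneg _) norm_coeffU_le).trans_lt h1
  have h3 : 1 - coeffU * mulOp 1 s a = (reweight hε hε1 s : Coeffs →L[ℂ] Coeffs)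
      * (1 - coeffU * mulOp ε s a) * ((reweight hε hε1 s)⁻¹ : (Coeffs →L[ℂ] Coeffs)ˣ) := by
    rw [Units.eq_mul_inv_iff_mul_eq, sub_mul, mul_sub, one_mul, mul_one, ← mul_assoc,
      reweight_mul_coeffU, mul_assoc, mul_assoc, reweight_mul_mulOp hε hε1 ha]
  rw [h3]
  exact ((Units.isUnit _).mul h2).mul (Units.isUnit _)

/-! ### Multiplication on `L₂` -/

section

variable {g : Torus → ℂ}

theorem memLp_mul (hg : Continuous g) {K : ℝ} (hK : ∀ x, ‖g x‖ ≤ K) (u : L2) :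
    MemLp (fun x => g x * u x) 2 torusMeasure := by
  refine (Lp.memLp u).of_le_mul (c := K)
    (hg.aestronglyMeasurable.mul (Lp.aestronglyMeasurable u)) (Filter.Eventually.of_forall fun x => ?_)
  rw [norm_mul]
  exact mul_le_mul_of_nonneg_right (hK x) (norm_nonneg _)

theorem exists_norm_le_of_continuous (hg : Continuous g) : ∃ K, ∀ x, ‖g x‖ ≤ K := by
  obtain ⟨K, hK⟩ := (isCompact_range hg).isBounded.exists_norm_le
  exact ⟨K, fun x => hK _ ⟨x, rfl⟩⟩

theorem coeFn_mulL2 (hg : Continuous g) (u : L2) :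
    mulL2 g u =ᵐ[torusMeasure] fun x => g x * u x := by
  obtain ⟨K, hK⟩ := exists_norm_le_of_continuous hg
  rw [mulL2, dif_pos (memLp_mul hg hK u)]
  exact MemLp.coeFn_toLp _

theorem norm_mulL2_le (hg : Continuous g) {K : ℝ} (hK : ∀ x, ‖g x‖ ≤ K) (u : L2) :
    ‖mulL2 g u‖ ≤ K * ‖u‖ := by
  refine Lp.norm_le_mul_norm_of_ae_le_mul ?_
  filter_upwards [coeFn_mulL2 hg u] with x hx
  rw [hx, norm_mul]
  exact mul_le_mul_of_nonneg_right (hK x) (norm_nonneg _)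

/-- For `u ∈ L₂ ⊆ L₁` the functional `h ↦ ∫ e_{-n} h u` is continuous in the sup norm, so the
uniformly convergent Fourier series of `g` may be integrated termwise; `e_{-n} e_j = e_{-(n-j)}`
yields the convolution. -/
theorem hasSum_fourierL2_mulL2 (hg : Continuous g) (ha : Summable (coef g)) (u : L2)
    (n : Fin 2 → ℤ) :
    HasSum (fun j => coef g j * fourierL2 u (n - j)) (fourierL2 (mulL2 g u) n) := by
  have hu : Integrable u torusMeasure := (Lp.memLp u).integrable (by norm_num)
  have hint : ∀ h : C(Torus, ℂ),
      Integrable (fun x => UnitAddTorus.mFourier (-n) x * (h x * u x)) torusMeasure := by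
    intro h
    have := hu.bdd_mul (c := ‖UnitAddTorus.mFourier (-n) * h‖)
      (f := fun x => (UnitAddTorus.mFourier (-n) * h) x)
      (UnitAddTorus.mFourier (-n) * h).continuous.aestronglyMeasurable
      (Filter.Eventually.of_forall fun x => ContinuousMap.norm_coe_le_norm _ x)
    simpa [mul_assoc] using this
  let Λ : C(Torus, ℂ) →L[ℂ] ℂ := LinearMap.mkContinuous
    { toFun := fun h => ∫ x, UnitAddTorus.mFourier (-n) x * (h x * u x) ∂torusMeasure
      map_add' := fun h k => by
        rw [← integral_add (hint h) (hint k)]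
        refine integral_congr_ae (Filter.Eventually.of_forall fun x => ?_)
        simp only [ContinuousMap.add_apply]
        ring
      map_smul' := fun c h => by
        rw [RingHom.id_apply, smul_eq_mul, ← integral_const_mul]
        refine integral_congr_ae (Filter.Eventually.of_forall fun x => ?_)
        simp only [ContinuousMap.smul_apply, smul_eq_mul]
        ring } (∫ x, ‖u x‖ ∂torusMeasure) (fun h => by
      rw [← integral_mul_const]
      refine norm_integral_le_of_norm_le (hu.norm.mul_const _)
        (Filter.Eventually.of_forall fun x => ?_)
      rw [norm_mul, norm_mFourier_apply, one_mul, norm_mul, mul_comm]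
      exact mul_le_mul_of_nonneg_left (ContinuousMap.norm_coe_le_norm h x) (norm_nonneg _))
  have h1 := (UnitAddTorus.hasSum_mFourier_series_of_summable (f := ⟨g, hg⟩) ha).mapL Λ
  convert h1 using 1
  · funext j
    rw [map_smul, fourierL2_apply, smul_eq_mul]
    congr 1
    refine integral_congr_ae (Filter.Eventually.of_forall fun x => ?_)
    change UnitAddTorus.mFourier (-(n - j)) x * u x
      = UnitAddTorus.mFourier (-n) x * (UnitAddTorus.mFourier j x * u x)
    rw [← mul_assoc, ← UnitAddTorus.mFourier_add]
    congr 3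
    abel
  · rw [fourierL2_apply, coef_congr_ae (coeFn_mulL2 hg u)]
    rfl

theorem WeightedSummable.of_le {s r : ℕ} (hrs : r ≤ s) {a : (Fin 2 → ℤ) → ℂ}
    (ha : WeightedSummable s a) : WeightedSummable r a := by
  refine Summable.of_nonneg_of_le (fun j => ?_) (fun j => ?_) ha
  · have := bracket_pos 1 j
    positivity
  · have := bracket_pos 1 j
    exact mul_le_mul_of_nonneg_left (pow_le_pow_right₀ (by linarith) hrs) (norm_nonneg _)

theorem WeightedSummable.summable {s : ℕ} {a : (Fin 2 → ℤ) → ℂ}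
    (ha : WeightedSummable s a) : Summable a := by
  have := ha.of_le (Nat.zero_le s)
  simp only [WeightedSummable, pow_zero, mul_one] at this
  exact this.of_norm

theorem mulOp_zero_fourierL2 (hg : Continuous g) {s : ℕ} (ha : WeightedSummable s (coef g)) (u : L2) :
    mulOp 0 s (coef g) (fourierL2 u) = fourierL2 (mulL2 g u) := by
  ext n
  have h1 := hasSum_mulOp_apply le_rfl zero_le_one ha (fourierL2 u) n
  simp only [bracket_zero, Complex.ofReal_one, div_one, one_pow, one_mul] at h1
  exact h1.unique (hasSum_fourierL2_mulL2 hg ha.summable u n)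

/-- By Plancherel the unweighted operator is multiplication on `L₂`, whose norm is controlled by the
sup norm of `g`. The cruder bound by the sum of `‖coef g j‖` could exceed `1`. -/
theorem norm_mulOp_zero_le (hg : Continuous g) {s : ℕ} (ha : WeightedSummable s (coef g)) {K : ℝ}
    (hK : ∀ x, ‖g x‖ ≤ K) : ‖mulOp 0 s (coef g)‖ ≤ K := by
  refine ContinuousLinearMap.opNorm_le_bound _ ((norm_nonneg _).trans (hK 0)) fun c => ?_
  obtain ⟨u, rfl⟩ := fourierL2.surjective c
  rw [mulOp_zero_fourierL2 hg ha, fourierL2.norm_map, fourierL2.norm_map]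
  exact norm_mulL2_le hg hK u

theorem isUnit_one_sub_coeffU_mul_coef (hg : Continuous g) {s : ℕ}
    (ha : WeightedSummable s (coef g)) (h : ∀ x, ‖g x‖ < 1) :
    IsUnit (1 - coeffU * mulOp 1 s (coef g)) := by
  refine isUnit_one_sub_coeffU_mul ha ?_
  -- The maximum is attained on the compact torus, so the pointwise strict bound is a strict bound
  -- on the sup norm.
  obtain ⟨x, hx⟩ := hg.norm.exists_forall_ge_of_hasCompactMulSupport
    (HasCompactMulSupport.of_compactSpace _)
  exact (norm_mulOp_zero_le hg ha hx).trans_lt (h x)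

end

/-! ### Summability over the lattice -/

theorem abs_fst_le_bracket (n : Fin 2 → ℤ) : |(n 0 : ℝ)| ≤ bracket 1 n :=
  Real.abs_le_sqrt (by nlinarith [sq_nonneg (n 1 : ℝ)])

theorem abs_snd_le_bracket (n : Fin 2 → ℤ) : |(n 1 : ℝ)| ≤ bracket 1 n :=
  Real.abs_le_sqrt (by nlinarith [sq_nonneg (n 0 : ℝ)])

theorem bracket_one_sq (n : Fin 2 → ℤ) : bracket 1 n ^ 2 = 1 + (n 0 : ℝ) ^ 2 + (n 1 : ℝ) ^ 2 := by
  rw [bracket, Real.sq_sqrt (by positivity)]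
  ring

theorem summable_bracket : Summable fun n : Fin 2 → ℤ => (bracket 1 n ^ 3)⁻¹ := by
  have h1 := EisensteinSeries.summable_one_div_norm_rpow (k := 3) (by norm_num)
  refine Summable.of_norm_bounded_eventually h1 ?_
  rw [Filter.eventually_cofinite]
  -- The comparison with the sup norm can fail only at `n = 0`.
  refine (finite_singleton (0 : Fin 2 → ℤ)).subset fun n hn => ?_
  by_contra h0
  refine hn ?_
  have h2 : 0 < ‖n‖ := norm_pos_iff.mpr h0
  have h3 : ‖n‖ ≤ bracket 1 n := by
    refine (pi_norm_le_iff_of_nonneg (bracket_pos 1 n).le).mpr fun i => ?_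
    rw [Int.norm_eq_abs]
    fin_cases i
    · exact abs_fst_le_bracket n
    · exact abs_snd_le_bracket n
  have h4 := bracket_pos 1 n
  rw [Real.norm_of_nonneg (by positivity), Real.rpow_neg h2.le]
  have h5 : ‖n‖ ^ (3 : ℝ) = ‖n‖ ^ 3 := by exact_mod_cast Real.rpow_natCast ‖n‖ 3
  rw [h5]
  exact inv_anti₀ (by positivity) (pow_le_pow_left₀ h2.le h3 3)

theorem IsSmoothFamily.exists_weighted_bound {g : Torus → ℝ → ℂ} (hg : IsSmoothFamily g) (s : ℕ) :
    ∃ C, ∀ t ∈ Icc (0 : ℝ) 1, ∀ n : Fin 2 → ℤ,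
      ‖coef (fun x => g x t) n‖ * (1 + bracket 1 n) ^ s ≤ C * (bracket 1 n ^ 3)⁻¹ := by
  -- This controls the power `2 * (s + 2)` of the bracket; `s + 3` is needed, `s` for the weight and
  -- `3` for summability.
  obtain ⟨C, hC⟩ := hg.exists_coef_bound (s + 2)
  refine ⟨2 ^ s * C, fun t ht n => ?_⟩
  have hb := one_le_bracket 1 n
  have hb0 := bracket_pos 1 n
  rw [← div_eq_mul_inv, le_div_iff₀ (by positivity)]
  have h1 : (1 + bracket 1 n) ^ s ≤ (2 * bracket 1 n) ^ s :=
    pow_le_pow_left₀ (by positivity) (by linarith) s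
  have h2 : bracket 1 n ^ s * bracket 1 n ^ 3 ≤ (1 + (n 0 : ℝ) ^ 2 + (n 1 : ℝ) ^ 2) ^ (s + 2) := by
    rw [← bracket_one_sq, ← pow_mul, ← pow_add]
    exact pow_le_pow_right₀ hb (by omega)
  calc _ ≤ ‖coef (fun x => g x t) n‖ * (2 * bracket 1 n) ^ s * bracket 1 n ^ 3 := by gcongr
    _ = 2 ^ s * (bracket 1 n ^ s * bracket 1 n ^ 3 * ‖coef (fun x => g x t) n‖) := by
      rw [mul_pow]
      ring
    _ ≤ 2 ^ s * C := by
      gcongr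
      exact (mul_le_mul_of_nonneg_right h2 (norm_nonneg _)).trans (hC t ht n)

theorem IsSmoothFamily.weightedSummable {g : Torus → ℝ → ℂ} (hg : IsSmoothFamily g) (s : ℕ) {t : ℝ}
    (ht : t ∈ Icc (0 : ℝ) 1) : WeightedSummable s (coef fun x => g x t) := by
  obtain ⟨C, hC⟩ := hg.exists_weighted_bound s
  refine Summable.of_nonneg_of_le (fun n => ?_) (hC t ht) (summable_bracket.mul_left C)
  have := bracket_pos 1 n
  positivity

/-! ### Smooth dependence on time of multiplication operators -/

theorem mulOp_sub {s : ℕ} {a b : (Fin 2 → ℤ) → ℂ} (ha : WeightedSummable s a)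
    (hb : WeightedSummable s b) : mulOp 1 s (a - b) = mulOp 1 s a - mulOp 1 s b := by
  rw [mulOp, mulOp, mulOp, ← (summable_mulShift zero_le_one le_rfl ha).tsum_sub
    (summable_mulShift zero_le_one le_rfl hb)]
  simp only [Pi.sub_apply, sub_smul]

theorem mulOp_smul (s : ℕ) (c : ℝ) (a : (Fin 2 → ℤ) → ℂ) :
    mulOp 1 s (c • a) = c • mulOp 1 s a := by
  rw [mulOp, mulOp, ← tsum_const_smul'']
  simp only [Pi.smul_apply, smul_assoc]

theorem WeightedSummable.sub {s : ℕ} {a b : (Fin 2 → ℤ) → ℂ} (ha : WeightedSummable s a)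
    (hb : WeightedSummable s b) : WeightedSummable s (a - b) := by
  refine Summable.of_nonneg_of_le (fun j => ?_) (fun j => ?_) (Summable.add ha hb)
  · have := bracket_pos 1 j
    positivity
  · have := bracket_pos 1 j
    rw [← add_mul]
    exact mul_le_mul_of_nonneg_right (norm_sub_le _ _) (by positivity)

theorem WeightedSummable.smul {s : ℕ} {a : (Fin 2 → ℤ) → ℂ} (ha : WeightedSummable s a) (c : ℝ) :
    WeightedSummable s (c • a) := by
  refine (Summable.mul_left |c| ha).congr fun j => ?_
  simp [mul_assoc]

namespace IsSmoothFamily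

variable {g : Torus → ℝ → ℂ}

/-- The operator norm is dominated by a weighted sum of coefficients. Each coefficient has a
quadratic Taylor remainder whose constant comes from the second time derivative and is summable
against the weight. -/
theorem hasDerivWithinAt_mulOp (hg : IsSmoothFamily g) (s : ℕ) {t : ℝ} (ht : t ∈ Icc (0 : ℝ) 1) :
    HasDerivWithinAt (fun τ => mulOp 1 s (coef fun x => g x τ))
      (mulOp 1 s (coef (TorusBeltrami.timeDeriv g t))) (Icc 0 1) t := by
  obtain ⟨C, hC⟩ := hg.timeDeriv.timeDeriv.exists_weighted_bound s
  refine hasDerivWithinAt_of_remainder_le (C := C * ∑' n, (bracket 1 n ^ 3)⁻¹) fun τ hτ => ?_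
  have h1 := hg.weightedSummable s hτ
  have h2 := hg.weightedSummable s ht
  have h3 : WeightedSummable s (coef (TorusBeltrami.timeDeriv g t)) :=
    hg.timeDeriv.weightedSummable s ht
  rw [← mulOp_smul, ← mulOp_sub h1 h2, ← mulOp_sub (h1.sub h2) (h3.smul _)]
  refine (norm_mulOp_le zero_le_one le_rfl ((h1.sub h2).sub (h3.smul _))).trans ?_
  rw [← tsum_mul_left, ← tsum_mul_right]
  refine Summable.tsum_le_tsum (fun n => ?_) ((h1.sub h2).sub (h3.smul _))
    ((summable_bracket.mul_left C).mul_right _)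
  have hb := bracket_pos 1 n
  have h4 := norm_taylor_remainder_le (convex_Icc (0 : ℝ) 1)
    (fun σ hσ => hg.hasDerivWithinAt_coef hσ n)
    (fun σ hσ => hg.timeDeriv.hasDerivWithinAt_coef hσ n)
    (C := C * (bracket 1 n ^ 3)⁻¹ / (1 + bracket 1 n) ^ s)
    (fun σ hσ => by
      rw [le_div_iff₀ (by positivity)]
      exact hC σ hσ n) ht hτ
  rw [div_mul_eq_mul_div, le_div_iff₀ (by positivity)] at h4
  exact h4

/-- The derivative is the same construction applied to the time derivative of the family, so the
induction runs over all families at once. -/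
theorem contDiffOn_mulOp (s k : ℕ) : ∀ {g : Torus → ℝ → ℂ}, IsSmoothFamily g →
    ContDiffOn ℝ k (fun τ => mulOp 1 s (coef fun x => g x τ)) (Icc 0 1) := by
  induction k with
  | zero =>
    intro g hg
    exact contDiffOn_zero.mpr fun t ht => (hg.hasDerivWithinAt_mulOp s ht).continuousWithinAt
  | succ k ih =>
    intro g hg
    push_cast
    rw [contDiffOn_succ_iff_derivWithin (uniqueDiffOn_Icc zero_lt_one)]
    refine ⟨fun t ht => (hg.hasDerivWithinAt_mulOp s ht).differentiableWithinAt,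
      fun h => absurd h (by simp), (ih hg.timeDeriv).congr fun t ht => ?_⟩
    exact (hg.hasDerivWithinAt_mulOp s ht).derivWithin (uniqueDiffOn_Icc zero_lt_one t ht)

end IsSmoothFamily

/-! ### The solution on weighted Fourier coefficients -/

/-- The (weighted) Fourier coefficients of the constant function `1`. -/
def oneCoeffs : Coeffs := lp.single 2 0 1

theorem oneCoeffs_apply (n : Fin 2 → ℤ) : oneCoeffs n = if n = 0 then 1 else 0 := by
  simp [oneCoeffs, lp.single_apply, Pi.single_apply]

/-- The operator `Id - U ∘ g(·,t)` on Fourier coefficients with weight `weight s`. -/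
def beltramiOp (s : ℕ) (g : Torus → ℝ → ℂ) (t : ℝ) : Coeffs →L[ℂ] Coeffs :=
  1 - coeffU * mulOp 1 s (coef fun x => g x t)

/-- The weighted Fourier coefficients of `(Id - U ∘ g(·,t))⁻¹ 1`. -/
def solCoeffs (s : ℕ) (g : Torus → ℝ → ℂ) (t : ℝ) : Coeffs :=
  Ring.inverse (beltramiOp s g t) oneCoeffs

section

variable {g : Torus → ℝ → ℂ}

theorem isUnit_beltramiOp (hg : IsSmoothFamily g)
    (hlt : ∀ x : Torus, ∀ t ∈ Icc (0 : ℝ) 1, ‖g x t‖ < 1) (s : ℕ) {t : ℝ} (ht : t ∈ Icc (0 : ℝ) 1) :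
    IsUnit (beltramiOp s g t) :=
  isUnit_one_sub_coeffU_mul_coef (hg.continuous_slice ht) (hg.weightedSummable s ht)
    fun x => hlt x t ht

theorem beltramiOp_solCoeffs (hg : IsSmoothFamily g)
    (hlt : ∀ x : Torus, ∀ t ∈ Icc (0 : ℝ) 1, ‖g x t‖ < 1) (s : ℕ) {t : ℝ} (ht : t ∈ Icc (0 : ℝ) 1) :
    beltramiOp s g t (solCoeffs s g t) = oneCoeffs := by
  rw [solCoeffs, ← mul_apply_eq_comp, Ring.mul_inverse_cancel _ (isUnit_beltramiOp hg hlt s ht),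
    one_apply_eq_self]

theorem contDiffOn_solCoeffs (hg : IsSmoothFamily g)
    (hlt : ∀ x : Torus, ∀ t ∈ Icc (0 : ℝ) 1, ‖g x t‖ < 1) (s k : ℕ) :
    ContDiffOn ℝ k (solCoeffs s g) (Icc 0 1) := by
  have h1 : ContDiffOn ℝ k (beltramiOp s g) (Icc 0 1) :=
    contDiffOn_const.sub (contDiffOn_const.mul (IsSmoothFamily.contDiffOn_mulOp s k hg))
  have h2 : ContDiffOn ℝ k (fun t => Ring.inverse (beltramiOp s g t)) (Icc 0 1) := by
    intro t ht
    obtain ⟨u, hu⟩ := isUnit_beltramiOp hg hlt s ht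
    have h3 := contDiffAt_ringInverse ℝ (n := k) u
    rw [hu] at h3
    exact h3.comp_contDiffWithinAt t (h1 t ht)
  exact (((ContinuousLinearMap.apply ℂ Coeffs oneCoeffs).restrictScalars ℝ).contDiff).comp_contDiffOn
    h2

/-- The derivative of `A⁻¹` is `-A⁻¹ A' A⁻¹`, and `A' = -U ∘ ν̇`. The signs cancel, and the
rightmost `A⁻¹` applied to `1` is the solution itself. -/
theorem hasDerivWithinAt_solCoeffs (hg : IsSmoothFamily g)
    (hlt : ∀ x : Torus, ∀ t ∈ Icc (0 : ℝ) 1, ‖g x t‖ < 1) (s : ℕ) {t : ℝ} (ht : t ∈ Icc (0 : ℝ) 1) :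
    HasDerivWithinAt (solCoeffs s g)
      (Ring.inverse (beltramiOp s g t)
        (coeffU (mulOp 1 s (coef (timeDeriv g t)) (solCoeffs s g t)))) (Icc 0 1) t := by
  have h1 : HasDerivWithinAt (beltramiOp s g) (-(coeffU * mulOp 1 s (coef (timeDeriv g t))))
      (Icc 0 1) t :=
    ((hg.hasDerivWithinAt_mulOp s ht).const_mul coeffU).const_sub 1
  obtain ⟨u, hu⟩ := isUnit_beltramiOp hg hlt s ht
  have h2 := hasFDerivAt_ringInverse (𝕜 := ℝ) u
  rw [hu] at h2
  have h3 := h2.comp_hasDerivWithinAt t h1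
  have h4 := ((ContinuousLinearMap.apply ℂ Coeffs oneCoeffs).restrictScalars
    ℝ).hasFDerivAt.comp_hasDerivWithinAt t h3
  convert! h4 using 1
  rw [solCoeffs, ← hu, Ring.inverse_unit]
  have h5 : (-(ContinuousLinearMap.mulLeftRight ℝ (Coeffs →L[ℂ] Coeffs) ↑u⁻¹ ↑u⁻¹))
      (-(coeffU * mulOp 1 s (coef (timeDeriv g t))))
      = (↑u⁻¹ : Coeffs →L[ℂ] Coeffs) * (coeffU * mulOp 1 s (coef (timeDeriv g t))) * ↑u⁻¹ := by
    rw [map_neg, neg_apply, neg_neg, ContinuousLinearMap.mulLeftRight_apply]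
  exact (congrArg (fun T : Coeffs →L[ℂ] Coeffs => T oneCoeffs) h5).symm

end

/-! ### Characters as functions of the coordinate -/

/-- The logarithmic derivative of the character `e_n`. -/
def charDeriv (n : Fin 2 → ℤ) : ℂ →L[ℝ] ℂ :=
  (Complex.I * n 0) • (Complex.ofRealCLM.comp Complex.reCLM)
    + (Complex.I * n 1) • (Complex.ofRealCLM.comp Complex.imCLM)

theorem charDeriv_apply (n : Fin 2 → ℤ) (w : ℂ) :
    charDeriv n w = Complex.I * (n 0 * w.re + n 1 * w.im) := by
  simp [charDeriv]
  ring

theorem norm_charDeriv_le (n : Fin 2 → ℤ) : ‖charDeriv n‖ ≤ 2 * bracket 1 n := by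
  have hb := bracket_pos 1 n
  refine ContinuousLinearMap.opNorm_le_bound _ (by positivity) fun w => ?_
  rw [charDeriv_apply, norm_mul, Complex.norm_I, one_mul]
  refine (norm_add_le _ _).trans ?_
  rw [norm_mul, norm_mul, Complex.norm_intCast, Complex.norm_intCast, Complex.norm_real,
    Complex.norm_real]
  have h1 := mul_le_mul (abs_fst_le_bracket n) (Complex.abs_re_le_norm w) (abs_nonneg _) hb.le
  have h2 := mul_le_mul (abs_snd_le_bracket n) (Complex.abs_im_le_norm w) (abs_nonneg _) hb.le
  simp only [Real.norm_eq_abs]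
  linarith

theorem mFourier_proj_eq (n : Fin 2 → ℤ) :
    (fun z => UnitAddTorus.mFourier n (proj z)) = fun z => Complex.exp (charDeriv n z) := by
  funext z
  rw [mFourier_proj, charDeriv_apply]

theorem hasFDerivAt_mFourier_proj (n : Fin 2 → ℤ) (z : ℂ) :
    HasFDerivAt (fun z => UnitAddTorus.mFourier n (proj z))
      (UnitAddTorus.mFourier n (proj z) • charDeriv n) z := by
  have h := (charDeriv n).hasFDerivAt (x := z) |>.cexp
  rw [← mFourier_proj_eq] at h
  rwa [mFourier_proj, ← charDeriv_apply]

theorem contDiff_mFourier_proj (n : Fin 2 → ℤ) {k : WithTop ℕ∞} :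
    ContDiff ℝ k fun z => UnitAddTorus.mFourier n (proj z) := by
  rw [mFourier_proj_eq]
  exact (charDeriv n).contDiff.cexp

theorem norm_iteratedFDeriv_mFourier_proj_le (n : Fin 2 → ℤ) (i : ℕ) (z : ℂ) :
    ‖iteratedFDeriv ℝ i (fun z => UnitAddTorus.mFourier n (proj z)) z‖ ≤ (2 * bracket 1 n) ^ i := by
  induction i with
  | zero => simp [norm_mFourier_apply]
  | succ i ih =>
    have hb := bracket_pos 1 n
    -- The derivative of a character is a fixed linear map applied to that character, so each
    -- differentiation costs one factor `‖L‖`.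
    set L : ℂ →L[ℝ] ℂ →L[ℝ] ℂ :=
      (ContinuousLinearMap.lsmul ℝ ℂ (E := ℂ →L[ℝ] ℂ)).flip (charDeriv n) with hL
    have hLn : ‖L‖ ≤ 2 * bracket 1 n := by
      refine ContinuousLinearMap.opNorm_le_bound _ (by positivity) fun c => ?_
      have : L c = c • charDeriv n := rfl
      rw [this, norm_smul, mul_comm]
      exact mul_le_mul_of_nonneg_right (norm_charDeriv_le n) (norm_nonneg _)
    have h1 : fderiv ℝ (fun z => UnitAddTorus.mFourier n (proj z))
        = L ∘ fun z => UnitAddTorus.mFourier n (proj z) := by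
      funext w
      exact (hasFDerivAt_mFourier_proj n w).fderiv
    rw [← norm_iteratedFDeriv_fderiv, h1, pow_succ']
    refine (L.norm_iteratedFDeriv_comp_left (N := i) (contDiff_mFourier_proj n).contDiffAt
      le_rfl).trans ?_
    exact mul_le_mul hLn ih (norm_nonneg _) (by positivity)

/-! ### Evaluation of Fourier series -/

/-- The sum at the point with coordinate `z` of the Fourier series with given weighted
coefficients. -/
def evalSeries (s : ℕ) (z : ℂ) : Coeffs →L[ℂ] ℂ :=
  ∑' n, UnitAddTorus.mFourier n (proj z) • ((weight s n : ℂ)⁻¹ • evalCoeff n)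

theorem norm_inv_weight_smul_evalCoeff_le (s : ℕ) (n : Fin 2 → ℤ) :
    ‖(weight s n : ℂ)⁻¹ • evalCoeff n‖ ≤ (bracket 1 n ^ s)⁻¹ := by
  rw [norm_smul, norm_inv, Complex.norm_real, Real.norm_of_nonneg (weight_pos s n).le, weight_eq]
  exact mul_le_of_le_one_right (by have := bracket_pos 1 n; positivity) (norm_evalCoeff_le n)

theorem evalSeries_apply {s : ℕ} (hs : 3 ≤ s) (z : ℂ) (c : Coeffs) :
    evalSeries s z c = ∑' n, (weight s n : ℂ)⁻¹ * c n * UnitAddTorus.mFourier n (proj z) := by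
  have h1 : Summable fun n : Fin 2 → ℤ =>
      UnitAddTorus.mFourier n (proj z) • ((weight s n : ℂ)⁻¹ • evalCoeff n) := by
    refine Summable.of_norm_bounded summable_bracket fun n => ?_
    rw [norm_smul, norm_mFourier_apply, one_mul]
    refine (norm_inv_weight_smul_evalCoeff_le s n).trans ?_
    have := one_le_bracket 1 n
    exact inv_anti₀ (by positivity) (pow_le_pow_right₀ this hs)
  have h2 := h1.hasSum.mapL (ContinuousLinearMap.apply ℂ ℂ c)
  refine (h2.congr_fun fun n => ?_).tsum_eq.symm
  change _ = UnitAddTorus.mFourier n (proj z) * ((weight s n : ℂ)⁻¹ * c n)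
  ring

/-- A Sobolev embedding, stated as regularity of `z ↦ δ_z` in the dual space: `i ≤ k` derivatives
cost `bracket ^ i`, the weight gains `bracket ^ s`, and a summable `bracket ^ (-3)` remains. -/
theorem contDiff_evalSeries {s k : ℕ} (hs : k + 3 ≤ s) : ContDiff ℝ k (evalSeries s) := by
  have key := contDiff_tsum (𝕜 := ℝ) (N := (k : ℕ∞))
    (f := fun (n : Fin 2 → ℤ) (z : ℂ) =>
      UnitAddTorus.mFourier n (proj z) • ((weight s n : ℂ)⁻¹ • evalCoeff n))
    (v := fun i n => 2 ^ i * (bracket 1 n ^ 3)⁻¹) ?_ ?_ ?_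
  · exact key
  · intro n
    exact (contDiff_mFourier_proj n).smul contDiff_const
  · intro i _
    exact summable_bracket.mul_left _
  · intro i n z hi
    have hi' : i ≤ k := by exact_mod_cast hi
    have hb := one_le_bracket 1 n
    set v : Coeffs →L[ℂ] ℂ := (weight s n : ℂ)⁻¹ • evalCoeff n with hv
    have hL := (ContinuousLinearMap.toSpanSingleton ℂ v).restrictScalars ℝ
      |>.norm_iteratedFDeriv_comp_left (x := z) (N := i) (n := i)
        (contDiff_mFourier_proj n).contDiffAt le_rfl
    refine hL.trans ?_
    rw [ContinuousLinearMap.norm_restrictScalars, ContinuousLinearMap.norm_toSpanSingleton]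
    refine (mul_le_mul (norm_inv_weight_smul_evalCoeff_le s n)
      (norm_iteratedFDeriv_mFourier_proj_le n i z) (norm_nonneg _) (by positivity)).trans ?_
    rw [mul_pow, mul_left_comm]
    refine mul_le_mul_of_nonneg_left ?_ (by positivity)
    rw [inv_mul_eq_div, div_le_iff₀ (by positivity), inv_mul_eq_div, le_div_iff₀ (by positivity),
      ← pow_add]
    exact pow_le_pow_right₀ hb (by omega)

/-- Termwise differentiation of Fourier series. -/
theorem hasFDerivAt_fourierSeries {a : (Fin 2 → ℤ) → ℂ} (ha : Summable fun n => ‖a n‖ * bracket 1 n)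
    (z : ℂ) :
    HasFDerivAt (fun w => ∑' n, a n * UnitAddTorus.mFourier n (proj w))
      (∑' n, (a n * UnitAddTorus.mFourier n (proj z)) • charDeriv n) z := by
  refine hasFDerivAt_tsum (x₀ := z) (u := fun n => 2 * (‖a n‖ * bracket 1 n))
    (f := fun n w => a n * UnitAddTorus.mFourier n (proj w))
    (f' := fun n w => (a n * UnitAddTorus.mFourier n (proj w)) • charDeriv n) (ha.mul_left 2)
    (fun n w => ?_) (fun n w => ?_) ?_ z
  · have := (hasFDerivAt_mFourier_proj n w).const_mul (a n)
    rwa [smul_smul] at this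
  · rw [norm_smul, norm_mul, norm_mFourier_apply, mul_one, mul_left_comm]
    exact mul_le_mul_of_nonneg_left (norm_charDeriv_le n) (norm_nonneg _)
  · refine Summable.of_norm_bounded ha fun n => ?_
    rw [norm_mul, norm_mFourier_apply, mul_one]
    exact le_mul_of_one_le_right (norm_nonneg _) (one_le_bracket 1 n)

theorem summable_smul_charDeriv {a : (Fin 2 → ℤ) → ℂ}
    (ha : Summable fun n => ‖a n‖ * bracket 1 n) (z : ℂ) :
    Summable fun n => (a n * UnitAddTorus.mFourier n (proj z)) • charDeriv n := by
  refine Summable.of_norm_bounded (ha.mul_left 2) fun n => ?_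
  rw [norm_smul, norm_mul, norm_mFourier_apply, mul_one, mul_left_comm]
  exact mul_le_mul_of_nonneg_left (norm_charDeriv_le n) (norm_nonneg _)

theorem hasSum_fderiv_fourierSeries {a : (Fin 2 → ℤ) → ℂ}
    (ha : Summable fun n => ‖a n‖ * bracket 1 n) (z w : ℂ) :
    HasSum (fun n => a n * UnitAddTorus.mFourier n (proj z) * (Complex.I * (n 0 * w.re + n 1 * w.im)))
      (fderiv ℝ (fun w => ∑' n, a n * UnitAddTorus.mFourier n (proj w)) z w) := by
  rw [(hasFDerivAt_fourierSeries ha z).fderiv]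
  have h1 := (summable_smul_charDeriv ha z).hasSum.mapL (ContinuousLinearMap.apply ℝ ℂ w)
  refine h1.congr_fun fun n => ?_
  rw [← charDeriv_apply]
  rfl

theorem hasSum_dz_fourierSeries {a : (Fin 2 → ℤ) → ℂ}
    (ha : Summable fun n => ‖a n‖ * bracket 1 n) (z : ℂ) :
    HasSum (fun n => Complex.I / 2 * UnitAddTorus.mFourier n (proj z)
        * (((n 0 : ℂ) - Complex.I * n 1) * a n))
      (dz (fun x => ∑' n, a n * UnitAddTorus.mFourier n x) z) := by
  have h := ((hasSum_fderiv_fourierSeries ha z 1).sub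
    ((hasSum_fderiv_fourierSeries ha z Complex.I).mul_left Complex.I)).div_const 2
  refine h.congr_fun fun n => ?_
  simp
  ring

theorem hasSum_dzbar_fourierSeries {a : (Fin 2 → ℤ) → ℂ}
    (ha : Summable fun n => ‖a n‖ * bracket 1 n) (z : ℂ) :
    HasSum (fun n => Complex.I / 2 * UnitAddTorus.mFourier n (proj z)
        * (((n 0 : ℂ) + Complex.I * n 1) * a n))
      (dzbar (fun x => ∑' n, a n * UnitAddTorus.mFourier n x) z) := by
  have h := ((hasSum_fderiv_fourierSeries ha z 1).add
    ((hasSum_fderiv_fourierSeries ha z Complex.I).mul_left Complex.I)).div_const 2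
  refine h.congr_fun fun n => ?_
  simp
  ring

/-! ### Sobolev spaces as weighted `ℓ₂` spaces -/

/-- Division of the coefficients by the weight. -/
def unweight (s : ℕ) : Coeffs →L[ℂ] Coeffs :=
  weightedShift (fun n => (weight s n : ℂ)⁻¹) 1 (fun n => by
    rw [norm_inv, Complex.norm_real, Real.norm_of_nonneg (weight_pos s n).le, weight_eq]
    exact inv_le_one_of_one_le₀ (one_le_pow₀ (one_le_bracket 1 n))) 0

theorem unweight_apply (s : ℕ) (c : Coeffs) (n : Fin 2 → ℤ) :
    unweight s c n = (weight s n : ℂ)⁻¹ * c n := by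
  rw [unweight, weightedShift_apply, sub_zero]

theorem weight_ne_zero (s : ℕ) (n : Fin 2 → ℤ) : (weight s n : ℂ) ≠ 0 :=
  Complex.ofReal_ne_zero.mpr (weight_pos s n).ne'

namespace Sobolev

theorem weightedCoeffs_apply (s : ℕ) (u : Sobolev s) (n : Fin 2 → ℤ) :
    weightedCoeffs s u n = (weight s n : ℂ) * fourierL2 (toL2 s u) n := rfl

theorem weightedCoeffs_surjective (s : ℕ) : Function.Surjective (weightedCoeffs s) := by
  intro c
  have h : ∀ n, (weight s n : ℂ) * fourierL2 (fourierL2.symm (unweight s c)) n = c n := by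
    intro n
    rw [LinearIsometryEquiv.apply_symm_apply, unweight_apply, mul_inv_cancel_left₀ (weight_ne_zero s n)]
  refine ⟨⟨fourierL2.symm (unweight s c), ?_⟩, ?_⟩
  · have h2 : (fun n => (weight s n : ℂ) * fourierL2 (fourierL2.symm (unweight s c)) n) = c :=
      funext h
    change Memℓp (fun n => (weight s n : ℂ) * fourierL2 (fourierL2.symm (unweight s c)) n) 2
    rw [h2]
    exact lp.memℓp c
  · ext n
    exact h n

/-- The isometry of `H^s(𝕋²)` onto the weighted coefficients. -/
def coeffsEquiv (s : ℕ) : Sobolev s ≃ₗᵢ[ℂ] Coeffs :=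
  LinearIsometryEquiv.ofSurjective ⟨weightedCoeffs s, fun _ => rfl⟩ (weightedCoeffs_surjective s)

theorem coeffsEquiv_apply (s : ℕ) (u : Sobolev s) : coeffsEquiv s u = weightedCoeffs s u := rfl

theorem fourierL2_toL2 (s : ℕ) (u : Sobolev s) :
    fourierL2 (toL2 s u) = unweight s (coeffsEquiv s u) := by
  ext n
  rw [unweight_apply, coeffsEquiv_apply, weightedCoeffs_apply,
    inv_mul_cancel_left₀ (weight_ne_zero s n)]

end Sobolev

/-! ### Compatibility of the multiplication operators -/

theorem unweight_coeffU (s : ℕ) (c : Coeffs) : unweight s (coeffU c) = coeffU (unweight s c) := by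
  ext n
  rw [unweight_apply, coeffU_apply, coeffU_apply, unweight_apply, mul_left_comm]

theorem unweight_mulOp {s : ℕ} {a : (Fin 2 → ℤ) → ℂ} (ha : WeightedSummable s a) (c : Coeffs) :
    unweight s (mulOp 1 s a c) = mulOp 1 0 a (unweight s c) := by
  ext n
  have h1 := (hasSum_mulOp_apply zero_le_one le_rfl ha c n).mul_left (weight s n : ℂ)⁻¹
  have h2 := hasSum_mulOp_apply zero_le_one le_rfl (ha.of_le (Nat.zero_le s)) (unweight s c) n
  rw [unweight_apply]
  refine h1.unique (h2.congr_fun fun j => ?_)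
  have h3 := bracket_ne_zero 1 n
  have h4 := bracket_ne_zero 1 (n - j)
  rw [unweight_apply, weight_eq, weight_eq]
  push_cast
  rw [pow_zero, one_mul, div_pow]
  field_simp

theorem mulOp_one_zero {a : (Fin 2 → ℤ) → ℂ} (s : ℕ) (ha : WeightedSummable s a) :
    mulOp 1 0 a = mulOp 0 s a := by
  ext c n
  have h1 := hasSum_mulOp_apply zero_le_one le_rfl (ha.of_le (Nat.zero_le s)) c n
  have h2 := hasSum_mulOp_apply le_rfl zero_le_one ha c n
  refine h1.unique (h2.congr_fun fun j => ?_)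
  simp [bracket_zero]

theorem mulOp_fourierL2 {g : Torus → ℂ} (hg : Continuous g) (ha : WeightedSummable 0 (coef g))
    (u : L2) : mulOp 1 0 (coef g) (fourierL2 u) = fourierL2 (mulL2 g u) := by
  rw [mulOp_one_zero 0 ha, mulOp_zero_fourierL2 hg ha]

theorem unweight_mulOp_coeffsEquiv {g : Torus → ℂ} (hg : Continuous g) {s : ℕ}
    (ha : WeightedSummable s (coef g)) (u : Sobolev s) :
    unweight s (coeffU (mulOp 1 s (coef g) (Sobolev.coeffsEquiv s u)))
      = fourierL2 (opU (mulL2 g (Sobolev.toL2 s u))) := by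
  rw [unweight_coeffU, unweight_mulOp ha, ← Sobolev.fourierL2_toL2,
    mulOp_fourierL2 hg (ha.of_le (Nat.zero_le s)), fourierL2_opU]

/-! ### The solution as a function -/

/-- The function `(Id - U ∘ g(·,t))⁻¹ 1`. -/
def sol (g : Torus → ℝ → ℂ) (x : Torus) (t : ℝ) : ℂ :=
  ∑' n, solCoeffs 0 g t n * UnitAddTorus.mFourier n x

theorem unweight_oneCoeffs (s : ℕ) : unweight s oneCoeffs = oneCoeffs := by
  ext n
  rw [unweight_apply, oneCoeffs_apply]
  split_ifs with h
  · subst h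
    simp [weight]
  · simp

section

variable {g : Torus → ℝ → ℂ} {t : ℝ}

/-- Removing the weight intertwines the operators for `s` and for `0`; injectivity of the latter
shows that all `s` give the same function. -/
theorem unweight_solCoeffs (hg : IsSmoothFamily g)
    (hlt : ∀ x : Torus, ∀ t ∈ Icc (0 : ℝ) 1, ‖g x t‖ < 1) (s : ℕ) (ht : t ∈ Icc (0 : ℝ) 1) :
    unweight s (solCoeffs s g t) = solCoeffs 0 g t := by
  have h1 := congrArg (unweight s) (beltramiOp_solCoeffs hg hlt s ht)
  have h2 : unweight s (beltramiOp s g t (solCoeffs s g t))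
      = beltramiOp 0 g t (unweight s (solCoeffs s g t)) := by
    change unweight s (solCoeffs s g t - coeffU (mulOp 1 s _ (solCoeffs s g t)))
      = unweight s (solCoeffs s g t) - coeffU (mulOp 1 0 _ (unweight s (solCoeffs s g t)))
    rw [map_sub, unweight_coeffU, unweight_mulOp (hg.weightedSummable s ht)]
  rw [h2, unweight_oneCoeffs] at h1
  calc unweight s (solCoeffs s g t)
      = Ring.inverse (beltramiOp 0 g t) (beltramiOp 0 g t (unweight s (solCoeffs s g t))) := by
        rw [← mul_apply_eq_comp, Ring.inverse_mul_cancel _ (isUnit_beltramiOp hg hlt 0 ht),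
          one_apply_eq_self]
    _ = solCoeffs 0 g t := by rw [h1, solCoeffs]

theorem solCoeffs_zero_apply (hg : IsSmoothFamily g)
    (hlt : ∀ x : Torus, ∀ t ∈ Icc (0 : ℝ) 1, ‖g x t‖ < 1) (s : ℕ) (ht : t ∈ Icc (0 : ℝ) 1)
    (n : Fin 2 → ℤ) : solCoeffs 0 g t n = (weight s n : ℂ)⁻¹ * solCoeffs s g t n := by
  rw [← unweight_solCoeffs hg hlt s ht, unweight_apply]

/-- The value at `(z, t)` is the pairing of a functional that is `C^k` in `z` with a vector that is
`C^k` in `t`, so no mixed derivatives need to be estimated. -/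
theorem isSmoothFamily_sol (hg : IsSmoothFamily g)
    (hlt : ∀ x : Torus, ∀ t ∈ Icc (0 : ℝ) 1, ‖g x t‖ < 1) : IsSmoothFamily (sol g) := by
  refine contDiffOn_infty.mpr fun k => ?_
  have h1 : ContDiffOn ℝ k (fun p : ℂ × ℝ => evalSeries (k + 3) p.1) (univ ×ˢ Icc (0 : ℝ) 1) :=
    ((contDiff_evalSeries le_rfl).comp contDiff_fst).contDiffOn
  have h2 : ContDiffOn ℝ k (fun p : ℂ × ℝ => solCoeffs (k + 3) g p.2) (univ ×ˢ Icc (0 : ℝ) 1) :=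
    (contDiffOn_solCoeffs hg hlt (k + 3) k).comp contDiff_snd.contDiffOn fun p hp => hp.2
  have h3 : ContDiffOn ℝ k (fun p : ℂ × ℝ => (evalSeries (k + 3) p.1).restrictScalars ℝ)
      (univ ×ˢ Icc (0 : ℝ) 1) :=
    (ContinuousLinearMap.restrictScalarsL ℂ Coeffs ℂ ℝ ℝ).contDiff.comp_contDiffOn h1
  refine (h3.clm_apply h2).congr fun p hp => ?_
  change sol g (proj p.1) p.2 = evalSeries (k + 3) p.1 (solCoeffs (k + 3) g p.2)
  rw [evalSeries_apply (by omega), sol]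
  simp only [solCoeffs_zero_apply hg hlt (k + 3) hp.2]

theorem summable_solCoeffs (hg : IsSmoothFamily g)
    (hlt : ∀ x : Torus, ∀ t ∈ Icc (0 : ℝ) 1, ‖g x t‖ < 1) (ht : t ∈ Icc (0 : ℝ) 1) :
    Summable fun n => ‖solCoeffs 0 g t n‖ * bracket 1 n := by
  refine Summable.of_nonneg_of_le (fun n => ?_) (fun n => ?_)
    -- Regularity `s = 4` pays for one factor of the bracket and leaves the summable power `3`.
    (summable_bracket.mul_left ‖solCoeffs 4 g t‖)
  · have := bracket_pos 1 n
    positivity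
  · have hb := bracket_pos 1 n
    rw [solCoeffs_zero_apply hg hlt 4 ht, norm_mul, norm_inv, Complex.norm_real,
      Real.norm_of_nonneg (weight_pos 4 n).le, weight_eq]
    have h1 : ‖solCoeffs 4 g t n‖ ≤ ‖solCoeffs 4 g t‖ := lp.norm_apply_le_norm (by simp) _ n
    calc _ = ‖solCoeffs 4 g t n‖ * (bracket 1 n ^ 3)⁻¹ := by
          field_simp
      _ ≤ _ := mul_le_mul_of_nonneg_right h1 (by positivity)

theorem summable_of_summable_mul_bracket {a : (Fin 2 → ℤ) → ℂ}
    (ha : Summable fun n => ‖a n‖ * bracket 1 n) : Summable a :=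
  Summable.of_norm_bounded ha fun n => le_mul_of_one_le_right (norm_nonneg _) (one_le_bracket 1 n)

/-- A summable Fourier series represents the square integrable function with the given
coefficients. -/
theorem coeFn_fourierL2_symm {c : Coeffs} (hc : Summable c) :
    fourierL2.symm c =ᵐ[torusMeasure] fun x => ∑' n, c n * UnitAddTorus.mFourier n x := by
  have h1 : Summable fun n => c n • (UnitAddTorus.mFourier n : C(Torus, ℂ)) := by
    refine Summable.of_norm_bounded hc.norm fun n => ?_
    rw [norm_smul, UnitAddTorus.mFourier_norm, mul_one]
  have h2 := h1.hasSum.mapL (ContinuousMap.toLp (E := ℂ) 2 torusMeasure ℂ)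
  have h3 : HasSum (fun n => c n • UnitAddTorus.mFourierLp 2 n) (fourierL2.symm c) := by
    have := (UnitAddTorus.mFourierBasis (d := Fin 2)).hasSum_repr_symm c
    rwa [UnitAddTorus.coe_mFourierBasis] at this
  have h4 := h3.unique (h2.congr_fun fun n => (map_smul _ _ _).symm)
  rw [h4]
  filter_upwards [ContinuousMap.coeFn_toLp (p := 2) (𝕜 := ℂ) torusMeasure
    (∑' n, c n • (UnitAddTorus.mFourier n : C(Torus, ℂ)))] with x hx
  rw [hx]
  have h5 := h1.hasSum.mapL (ContinuousMap.evalCLM ℂ x)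
  exact h5.tsum_eq.symm

theorem coeFn_sol (hg : IsSmoothFamily g)
    (hlt : ∀ x : Torus, ∀ t ∈ Icc (0 : ℝ) 1, ‖g x t‖ < 1) (ht : t ∈ Icc (0 : ℝ) 1) :
    fourierL2.symm (solCoeffs 0 g t) =ᵐ[torusMeasure] fun x => sol g x t :=
  coeFn_fourierL2_symm (summable_of_summable_mul_bracket (summable_solCoeffs hg hlt ht))

theorem coef_sol (hg : IsSmoothFamily g)
    (hlt : ∀ x : Torus, ∀ t ∈ Icc (0 : ℝ) 1, ‖g x t‖ < 1) (ht : t ∈ Icc (0 : ℝ) 1)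
    (n : Fin 2 → ℤ) : coef (fun x => sol g x t) n = solCoeffs 0 g t n := by
  rw [← coef_congr_ae (coeFn_sol hg hlt ht), ← fourierL2_apply,
    LinearIsometryEquiv.apply_symm_apply]

/-! ### The Beltrami equation on Fourier coefficients -/

theorem solCoeffs_eq_add (hg : IsSmoothFamily g)
    (hlt : ∀ x : Torus, ∀ t ∈ Icc (0 : ℝ) 1, ‖g x t‖ < 1) (ht : t ∈ Icc (0 : ℝ) 1)
    (n : Fin 2 → ℤ) :
    solCoeffs 0 g t n
      = (if n = 0 then 1 else 0) + eigU n * coef (fun x => g x t * sol g x t) n := by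
  have h1 : mulOp 1 0 (coef fun x => g x t) (solCoeffs 0 g t)
      = fourierL2 (mulL2 (fun x => g x t) (fourierL2.symm (solCoeffs 0 g t))) := by
    rw [← mulOp_fourierL2 (hg.continuous_slice ht) (hg.weightedSummable 0 ht),
      LinearIsometryEquiv.apply_symm_apply]
  have h2 : fourierL2 (mulL2 (fun x => g x t) (fourierL2.symm (solCoeffs 0 g t))) n
      = coef (fun x => g x t * sol g x t) n := by
    rw [fourierL2_apply, coef_congr_ae (coeFn_mulL2 (hg.continuous_slice ht) _)]
    refine coef_congr_ae ?_ n
    filter_upwards [coeFn_sol hg hlt ht] with x hx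
    rw [hx]
  have h3 := congrArg (fun c : Coeffs => c n) (beltramiOp_solCoeffs hg hlt 0 ht)
  change solCoeffs 0 g t n - eigU n * mulOp 1 0 (coef fun x => g x t) (solCoeffs 0 g t) n
    = oneCoeffs n at h3
  rw [h1, h2, oneCoeffs_apply] at h3
  rw [← h3]
  ring

/-- Since `|eigU n| = 1`, the fixed point equation makes the coefficients of `ν f` as large as those
of `f - 1`, so their decay is inherited. -/
theorem summable_coef_mul_sol (hg : IsSmoothFamily g)
    (hlt : ∀ x : Torus, ∀ t ∈ Icc (0 : ℝ) 1, ‖g x t‖ < 1) (ht : t ∈ Icc (0 : ℝ) 1) :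
    Summable fun n => ‖coef (fun x => g x t * sol g x t) n‖ * bracket 1 n := by
  refine Summable.of_nonneg_of_le (fun n => ?_) (fun n => ?_)
    ((summable_solCoeffs hg hlt ht).add (hasSum_ite_eq (0 : Fin 2 → ℤ) (1 : ℝ)).summable)
  · have := bracket_pos 1 n
    positivity
  · have hb := bracket_pos 1 n
    have h1 : eigU n * coef (fun x => g x t * sol g x t) n
        = solCoeffs 0 g t n - if n = 0 then 1 else 0 := by
      rw [solCoeffs_eq_add hg hlt ht n]
      ring
    have h2 : ‖coef (fun x => g x t * sol g x t) n‖
        = ‖solCoeffs 0 g t n - if n = 0 then 1 else 0‖ := by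
      rw [← h1, norm_mul, norm_eigU, one_mul]
    rw [h2]
    refine (mul_le_mul_of_nonneg_right (norm_sub_le _ _) hb.le).trans ?_
    rw [add_mul]
    refine add_le_add le_rfl ?_
    split_ifs with h
    · subst h
      simp [bracket]
    · simp

theorem mul_sol_eq_tsum (hg : IsSmoothFamily g)
    (hlt : ∀ x : Torus, ∀ t ∈ Icc (0 : ℝ) 1, ‖g x t‖ < 1) (ht : t ∈ Icc (0 : ℝ) 1) :
    (fun x => g x t * sol g x t)
      = fun x => ∑' n, coef (fun x => g x t * sol g x t) n * UnitAddTorus.mFourier n x := by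
  have hc : Continuous fun x => g x t * sol g x t :=
    (hg.continuous_slice ht).mul ((isSmoothFamily_sol hg hlt).continuous_slice ht)
  funext x
  exact (UnitAddTorus.hasSum_mFourier_series_apply_of_summable (f := ⟨_, hc⟩)
    (summable_of_summable_mul_bracket (summable_coef_mul_sol hg hlt ht)) x).tsum_eq.symm

theorem add_mul_eigU (n : Fin 2 → ℤ) (hn : n ≠ 0) :
    ((n 0 : ℂ) + Complex.I * n 1) * eigU n = (n 0 : ℂ) - Complex.I * n 1 := by
  have h : (n 0 : ℂ) + Complex.I * n 1 ≠ 0 := by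
    intro h0
    have h1 := norm_eigU n
    rw [eigU, if_neg hn, h0] at h1
    simp at h1
  rw [eigU, if_neg hn, mul_div_cancel₀ _ h]

/-- Multiplying the fixed point equation by `n₁ + i n₂` removes the constant mode and turns `eigU n`
into `n₁ - i n₂`. -/
theorem dzbar_sol (hg : IsSmoothFamily g)
    (hlt : ∀ x : Torus, ∀ t ∈ Icc (0 : ℝ) 1, ‖g x t‖ < 1) (ht : t ∈ Icc (0 : ℝ) 1) (z : ℂ) :
    dzbar (fun x => sol g x t) z = dz (fun x => g x t * sol g x t) z := by
  have h1 := hasSum_dzbar_fourierSeries (summable_solCoeffs hg hlt ht) z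
  have h2 := hasSum_dz_fourierSeries (summable_coef_mul_sol hg hlt ht) z
  rw [← mul_sol_eq_tsum hg hlt ht] at h2
  refine h1.unique (h2.congr_fun fun n => ?_)
  congr 1
  rcases eq_or_ne n 0 with rfl | hn
  · simp
  · rw [solCoeffs_eq_add hg hlt ht n, if_neg hn, zero_add, ← mul_assoc, add_mul_eigU n hn]

/-! ### Nonvanishing, the initial value and the evolution equation -/

theorem exists_sol_ne_zero (hg : IsSmoothFamily g)
    (hlt : ∀ x : Torus, ∀ t ∈ Icc (0 : ℝ) 1, ‖g x t‖ < 1) (ht : t ∈ Icc (0 : ℝ) 1) :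
    ∃ x, sol g x t ≠ 0 := by
  by_contra! h
  have h1 : solCoeffs 0 g t = 0 := by
    ext n
    rw [← coef_sol hg hlt ht]
    simp [coef, h]
  have h2 := beltramiOp_solCoeffs hg hlt 0 ht
  rw [h1, map_zero] at h2
  have h3 := congrArg (fun c : Coeffs => c 0) h2
  simp [oneCoeffs_apply] at h3

theorem sol_zero (h0 : ∀ x, g x 0 = 0) (x : Torus) : sol g x 0 = 1 := by
  have h1 : solCoeffs 0 g 0 = oneCoeffs := by
    have h2 : (coef fun x => g x 0) = 0 := by
      funext n
      simp [coef, h0]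
    simp [solCoeffs, beltramiOp, h2, mulOp]
  rw [sol, h1, tsum_eq_single 0]
  · simp [oneCoeffs_apply, UnitAddTorus.mFourier_zero]
  · intro n hn
    simp [oneCoeffs_apply, hn]

open Classical in
theorem solvesODE_sol (hg : IsSmoothFamily g)
    (hlt : ∀ x : Torus, ∀ t ∈ Icc (0 : ℝ) 1, ‖g x t‖ < 1) (s : ℕ) : SolvesODE s g (sol g) := by
  let e := (Sobolev.coeffsEquiv s).toContinuousLinearEquiv
  refine ⟨fun t => e.symm (solCoeffs s g t),
    -- The alternative value, the identity, is never used for `t ∈ [0,1]`.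
    fun t => if h : IsUnit (beltramiOp s g t) then
      (e.trans (ContinuousLinearEquiv.unitsEquiv ℂ Coeffs h.unit)).trans e.symm
      else ContinuousLinearEquiv.refl ℂ _,
    fun t => (e.symm : Coeffs →L[ℂ] Sobolev s).comp
      ((coeffU * mulOp 1 s (coef (timeDeriv g t))).comp (e : Sobolev s →L[ℂ] Coeffs)),
    fun t ht => ⟨?_, fun u => ?_, fun u => ?_, ?_⟩⟩
  · have h1 : Sobolev.toL2 s (e.symm (solCoeffs s g t)) = fourierL2.symm (solCoeffs 0 g t) := by
      rw [← unweight_solCoeffs hg hlt s ht, LinearIsometryEquiv.eq_symm_apply,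
        Sobolev.fourierL2_toL2]
      exact congrArg _ (e.apply_symm_apply _)
    rw [h1]
    exact coeFn_sol hg hlt ht
  · beta_reduce
    rw [dif_pos (isUnit_beltramiOp hg hlt s ht)]
    apply fourierL2.injective
    rw [Sobolev.fourierL2_toL2, map_sub, Sobolev.fourierL2_toL2,
      ← unweight_mulOp_coeffsEquiv (hg.continuous_slice ht) (hg.weightedSummable s ht), ← map_sub]
    exact congrArg _ (e.apply_symm_apply _)
  · apply fourierL2.injective
    rw [Sobolev.fourierL2_toL2, ← unweight_mulOp_coeffsEquiv (hg.timeDeriv.continuous_slice ht)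
      (hg.timeDeriv.weightedSummable s ht)]
    exact congrArg _ (e.apply_symm_apply _)
  · have hu := isUnit_beltramiOp hg hlt s ht
    beta_reduce
    rw [dif_pos hu]
    have h1 := ((e.symm : Coeffs →L[ℂ] Sobolev s).restrictScalars
      ℝ).hasFDerivAt.comp_hasDerivWithinAt t (hasDerivWithinAt_solCoeffs hg hlt s ht)
    convert! h1 using 1
    change e.symm ((↑hu.unit⁻¹ : Coeffs →L[ℂ] Coeffs) (e (e.symm (coeffU (mulOp 1 s _
      (e (e.symm (solCoeffs s g t)))))))) = e.symm _
    rw [e.apply_symm_apply, e.apply_symm_apply, Ring.inverse_of_isUnit hu]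

end

end TorusBeltrami

end

theorem mainTheorem12 (ν : TorusBeltrami.Torus → ℝ → ℂ)
    (hν : TorusBeltrami.IsSmoothFamily ν)
    (hν_lt : ∀ x : TorusBeltrami.Torus, ∀ t ∈ Set.Icc (0 : ℝ) 1, ‖ν x t‖ < 1)
    (hν_zero : ∀ x : TorusBeltrami.Torus, ν x 0 = 0) :
    ∃ f : TorusBeltrami.Torus → ℝ → ℂ,
      TorusBeltrami.IsSmoothFamily f ∧
      (∀ t ∈ Set.Icc (0 : ℝ) 1, ∀ z : ℂ,
        TorusBeltrami.dzbar (fun x => f x t) z = TorusBeltrami.dz (fun x => ν x t * f x t) z) ∧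
      (∀ x : TorusBeltrami.Torus, f x 0 = 1) ∧
      (∀ t ∈ Set.Icc (0 : ℝ) 1, ∃ x : TorusBeltrami.Torus, f x t ≠ 0) ∧
      (∀ s : ℕ, TorusBeltrami.SolvesODE s ν f) :=
  ⟨TorusBeltrami.sol ν, TorusBeltrami.isSmoothFamily_sol hν hν_lt,
    fun _ ht z => TorusBeltrami.dzbar_sol hν hν_lt ht z, TorusBeltrami.sol_zero hν_zero,
    fun _ ht => TorusBeltrami.exists_sol_ne_zero hν hν_lt ht,
    TorusBeltrami.solvesODE_sol hν hν_lt⟩
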